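/- Let $K=\mathbb{Q}(q)$, let $n\ge 0$, and let $O_q(M(n))$ be the associative unital $K$-algebra generated by $Z_{ij}$, $1\le i,j\le n$, with the relations $$Z_{ij}Z_{ik}=q^2Z_{ik}Z_{ij}\ (j<k),\qquad Z_{ij}Z_{kj}=q^2Z_{kj}Z_{ij}\ (i<k),$$ $$Z_{ij}Z_{st}=Z_{st}Z_{ij}\ (i>s,\ j<t),\qquad Z_{ij}Z_{st}=Z_{st}Z_{ij}+(q^2-q^{-2})Z_{it}Z_{sj}\ (i<s,\ j<t).$$ Let $x\mapsto\bar x$ be the ring anti-automorphism of $O_q(M(n))$ over $\mathbb{Q}$ with $\bar q=q^{-1}$ and $\overline{Z_{ij}}=Z_{ij}$, and let $\sigma$ be the $K$-algebra automorphism with $\sigma(Z_{ij})=Z_{ji}$. For $A=(a_{ij})\in M_n(\mathbb{Z}_+)$, where $\mathbb{Z}_+=\{0,1,2,\dots\}$, let $Z^A=\prod_{i,j}Z_{ij}^{a_{ij}}$ with the factors in the lexicographic order of the pairs $(i,j)$, and let $$Z(A)=q^{-\sum_i\sum_{j>k}a_{ij}a_{ik}-\sum_i\sum_{j>k}a_{ji}a_{ki}}\,Z^A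 .$$ Let $ro(A)$ and $co(A)$ be the vectors of row sums and of column sums of $A$, let $<$ be the lexicographic order on $M_n(\mathbb{Z}_+)$ (entries compared in the lexicographic order of their positions), and let $L^*$ be the $\mathbb{Z}[q]$-submodule of $O_q(M(n))$ spanned by all $Z(A)$. There is a unique family $b(A)$, $A\in M_n(\mathbb{Z}_+)$, that is a $\mathbb{Z}[q]$-basis of $L^*$ and satisfies, for all $A$, 1. $\overline{b(A)}=b(A)$; 2. $b(A)=Z(A)+\sum_{B}h_B(A)Z(B)$, a finite sum over matrices $B<A$ with $ro(B)=ro(A)$ and $co(B)=co(A)$, where $h_B(A)\in q\mathbb{Z}[q]$. The basis $B^*=\{b(A) : A\in M_n(\mathbb{Z}_+)\}$ is invariant under $\sigma$, that is $\sigma(B^*)=B^*$. More precisely, $$\sigma(b(A))=b(A^T)\qquad\text{for all } A\in M_n(\mathbb{Z}_+).$$ -/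

import Mathlib

namespace QuantumMatrix

noncomputable section

/-- The base field `K = ℚ(q)`. -/
abbrev K : Type := RatFunc ℚ

/-- The indeterminate `q`. -/
def q : K := RatFunc.X

lemma q_ne_zero : q ≠ 0 := RatFunc.X_ne_zero

lemma eval_q_inv_injective :
    Function.Injective (Polynomial.eval₂RingHom (algebraMap ℚ K) (q⁻¹ : K)) := by
  have h : Transcendental ℚ (q⁻¹ : K) := by
    intro h
    have h2 : IsAlgebraic ℚ (q⁻¹⁻¹ : K) := h.inv
    rw [inv_inv] at h2
    have h3 := RatFunc.transcendental_X (K := ℚ)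
    apply h3
    convert h2
    · exact Subsingleton.elim _ _
    · rfl
  exact transcendental_iff_injective.mp h

/-- The endomorphism of the field `K = ℚ(q)` with `q ↦ q⁻¹`. -/
def barK : K →+* K :=
  RatFunc.liftRingHom (Polynomial.eval₂RingHom (algebraMap ℚ K) (q⁻¹ : K))
    (nonZeroDivisors_le_comap_nonZeroDivisors_of_injective _ eval_q_inv_injective)

lemma barK_q : barK q = q⁻¹ := by
  have h := RatFunc.liftRingHom_apply_div
    (Polynomial.eval₂RingHom (algebraMap ℚ K) (q⁻¹ : K))
    (nonZeroDivisors_le_comap_nonZeroDivisors_of_injective _ eval_q_inv_injective)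
    Polynomial.X 1
  rw [RatFunc.algebraMap_X, map_one, div_one, map_one, div_one,
    Polynomial.coe_eval₂RingHom, Polynomial.eval₂_X] at h
  exact h

/-- Index set of the generators: pairs `(i, j)` with `1 ≤ i, j ≤ n`. -/
abbrev Idx (n : ℕ) : Type := Fin n × Fin n

/-- The generator of the free algebra with index `(i, j)`. -/
abbrev freeZ {n : ℕ} (i j : Fin n) : FreeAlgebra K (Idx n) := FreeAlgebra.ι K (i, j)

/-- The defining relations of the algebra of quantum `n × n` matrices. -/
inductive Rel (n : ℕ) : FreeAlgebra K (Idx n) → FreeAlgebra K (Idx n) → Prop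
  | row (i j k : Fin n) (hjk : j < k) :
      Rel n (freeZ i j * freeZ i k) ((q ^ 2) • (freeZ i k * freeZ i j))
  | col (i j k : Fin n) (hik : i < k) :
      Rel n (freeZ i j * freeZ k j) ((q ^ 2) • (freeZ k j * freeZ i j))
  | anti (i j s t : Fin n) (his : s < i) (hjt : j < t) :
      Rel n (freeZ i j * freeZ s t) (freeZ s t * freeZ i j)
  | diag (i j s t : Fin n) (his : i < s) (hjt : j < t) :
      Rel n (freeZ i j * freeZ s t)
        (freeZ s t * freeZ i j + (q ^ 2 - (q⁻¹) ^ 2) • (freeZ i t * freeZ s j))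

/-- The coordinate algebra `O_q(M(n))` of the quantum `n × n` matrices: the associative unital
`K`-algebra with generators `Z i j` and the relations `Rel n`. -/
def O (n : ℕ) : Type := RingQuot (Rel n)

instance (n : ℕ) : Ring (O n) := inferInstanceAs (Ring (RingQuot (Rel n)))

instance (n : ℕ) : Algebra K (O n) := inferInstanceAs (Algebra K (RingQuot (Rel n)))

variable {n : ℕ}

/-- The quotient map from the free algebra. -/
def mk (n : ℕ) : FreeAlgebra K (Idx n) →ₐ[K] O n := RingQuot.mkAlgHom K (Rel n)

lemma mk_rel {x y : FreeAlgebra K (Idx n)} (h : Rel n x y) : mk n x = mk n y :=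
  RingQuot.mkAlgHom_rel K h

/-- The universal property of the quotient. -/
def lift {B : Type*} [Ring B] [Algebra K B] (f : FreeAlgebra K (Idx n) →ₐ[K] B)
    (hf : ∀ ⦃x y⦄, Rel n x y → f x = f y) : O n →ₐ[K] B :=
  RingQuot.liftAlgHom K ⟨f, hf⟩

lemma lift_mk {B : Type*} [Ring B] [Algebra K B] (f : FreeAlgebra K (Idx n) →ₐ[K] B)
    (hf : ∀ ⦃x y⦄, Rel n x y → f x = f y) (x : FreeAlgebra K (Idx n)) :
    lift f hf (mk n x) = f x :=
  RingQuot.liftAlgHom_mkAlgHom_apply K f hf x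

/-- The generators `Z_{ij}`. -/
def Z (i j : Fin n) : O n := mk n (freeZ i j)

lemma Z_row (i j k : Fin n) (hjk : j < k) :
    Z i j * Z i k = (q ^ 2) • (Z i k * Z i j) := by
  simpa [Z] using mk_rel (Rel.row i j k hjk)

lemma Z_col (i j k : Fin n) (hik : i < k) :
    Z i j * Z k j = (q ^ 2) • (Z k j * Z i j) := by
  simpa [Z] using mk_rel (Rel.col i j k hik)

lemma Z_anti (i j s t : Fin n) (his : s < i) (hjt : j < t) :
    Z i j * Z s t = Z s t * Z i j := by
  simpa only [Z, map_mul] using mk_rel (Rel.anti i j s t his hjt)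

lemma Z_diag (i j s t : Fin n) (his : i < s) (hjt : j < t) :
    Z i j * Z s t = Z s t * Z i j + (q ^ 2 - (q⁻¹) ^ 2) • (Z i t * Z s j) := by
  simpa only [Z, map_mul, map_add, map_smul] using
    mk_rel (Rel.diag i j s t his hjt)

/-- Two `K`-algebra homomorphisms on `O_q(M(n))` that agree on the generators are equal. -/
lemma algHom_ext {B : Type*} [Ring B] [Algebra K B] {f g : O n →ₐ[K] B}
    (h : ∀ i j, f (Z i j) = g (Z i j)) : f = g := by
  refine RingQuot.ringQuot_ext' K (s := Rel n) f g ?_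
  apply FreeAlgebra.hom_ext
  funext p
  exact h p.1 p.2

/-! ### The transpose automorphism -/

/-- The `K`-algebra endomorphism with `Z_{ij} ↦ Z_{ji}`. -/
def sigmaHom (n : ℕ) : O n →ₐ[K] O n :=
  lift (FreeAlgebra.lift K fun p : Idx n => Z p.2 p.1) <| by
    intro x y h
    cases h with
    | row i j k hjk => simpa using Z_col j i k hjk
    | col i j k hik => simpa using Z_row j i k hik
    | anti i j s t his hjt => simpa using (Z_anti t s j i hjt his).symm
    | diag i j s t his hjt =>
      simpa [Z_anti t i j s hjt his] using Z_diag j i t s hjt his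

lemma sigmaHom_Z (i j : Fin n) : sigmaHom n (Z i j) = Z j i := by
  simp [sigmaHom, Z, lift_mk]

lemma sigmaHom_comp : (sigmaHom n).comp (sigmaHom n) = AlgHom.id K (O n) :=
  algHom_ext fun i j => by simp [sigmaHom_Z]

/-- The `K`-algebra automorphism `σ` of `O_q(M(n))` with `σ(Z_{ij}) = Z_{ji}`. -/
def sigma (n : ℕ) : O n ≃ₐ[K] O n :=
  AlgEquiv.ofAlgHom (sigmaHom n) (sigmaHom n) sigmaHom_comp sigmaHom_comp

lemma sigma_Z (i j : Fin n) : sigma n (Z i j) = Z j i := sigmaHom_Z i j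

/-! ### The bar involution -/

/-- The opposite ring of `O_q(M(n))`, on which `K` acts through `q ↦ q⁻¹`.  A `K`-algebra
homomorphism from `O_q(M(n))` to it is the same as a ring anti-endomorphism of `O_q(M(n))` that
sends `q` to `q⁻¹`. -/
def BarOp (n : ℕ) : Type := (O n)ᵐᵒᵖ

instance (n : ℕ) : Ring (BarOp n) := inferInstanceAs (Ring (O n)ᵐᵒᵖ)

instance (n : ℕ) : Algebra K (BarOp n) :=
  RingHom.toAlgebra' (((algebraMap K (O n)ᵐᵒᵖ).comp barK : K →+* (O n)ᵐᵒᵖ))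
    (fun c x => Algebra.commutes (A := (O n)ᵐᵒᵖ) (barK c) x)

/-- The identification of `O_q(M(n))` with its opposite, as an additive map. -/
def BarOp.of (n : ℕ) : O n ≃+ BarOp n := MulOpposite.opAddEquiv

lemma BarOp.of_mul (x y : O n) : BarOp.of n (x * y) = BarOp.of n y * BarOp.of n x := rfl

lemma BarOp.smul_of (c : K) (x : O n) : c • BarOp.of n x = BarOp.of n (barK c • x) := by
  rw [Algebra.smul_def, Algebra.smul_def, Algebra.commutes, BarOp.of_mul]
  rfl

lemma smul_inv_aux (x y : O n) (h : x = (q ^ 2) • y) : y = (barK (q ^ 2)) • x := by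
  rw [h, smul_smul, map_pow, barK_q, ← mul_pow, inv_mul_cancel₀ q_ne_zero, one_pow, one_smul]

/-- The bar map, as a `K`-algebra homomorphism into `BarOp n`. -/
def barHom (n : ℕ) : O n →ₐ[K] BarOp n :=
  lift (FreeAlgebra.lift K fun p : Idx n => BarOp.of n (Z p.1 p.2)) <| by
    intro x y h
    cases h with
    | row i j k hjk =>
      simp only [map_mul, map_smul, FreeAlgebra.lift_ι_apply, ← BarOp.of_mul, BarOp.smul_of]
      exact congrArg _ (smul_inv_aux _ _ (Z_row i j k hjk))
    | col i j k hik =>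
      simp only [map_mul, map_smul, FreeAlgebra.lift_ι_apply, ← BarOp.of_mul, BarOp.smul_of]
      exact congrArg _ (smul_inv_aux _ _ (Z_col i j k hik))
    | anti i j s t his hjt =>
      simp only [map_mul, FreeAlgebra.lift_ι_apply, ← BarOp.of_mul]
      exact congrArg _ (Z_anti i j s t his hjt).symm
    | diag i j s t his hjt =>
      simp only [map_mul, map_smul, map_add, FreeAlgebra.lift_ι_apply, ← BarOp.of_mul,
        BarOp.smul_of]
      rw [← map_add, Z_diag i j s t his hjt, Z_anti s j i t his hjt]
      simp only [map_sub, map_pow, map_inv₀, barK_q, inv_inv]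
      congr 1
      rw [add_assoc, ← add_smul]
      simp

/-- The bar map `x ↦ x̄` of `O_q(M(n))`: the ring anti-automorphism over `ℚ` with `q ↦ q⁻¹` and
`Z_{ij} ↦ Z_{ij}`. -/
def bar (x : O n) : O n := (BarOp.of n).symm (barHom n x)

lemma bar_Z (i j : Fin n) : bar (Z i j) = Z i j := by
  simp [bar, barHom, Z, lift_mk]

lemma bar_add (x y : O n) : bar (x + y) = bar x + bar y := by simp [bar]

lemma bar_one : bar (1 : O n) = 1 := by
  rw [bar, map_one]; rfl

lemma bar_mul (x y : O n) : bar (x * y) = bar y * bar x := by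
  rw [bar, map_mul]; rfl

lemma bar_smul (c : K) (x : O n) : bar (c • x) = barK c • bar x := by
  rw [bar, map_smul, AddEquiv.symm_apply_eq, ← BarOp.smul_of]
  simp [bar]

lemma barK_barK (c : K) : barK (barK c) = c := by
  have h : (barK.comp barK : K →+* K) = RingHom.id K := by
    apply IsLocalization.ringHom_ext (nonZeroDivisors (Polynomial ℚ))
    apply Polynomial.ringHom_ext
    · intro a
      exact congrFun (congrArg DFunLike.coe
        (Subsingleton.elim (((barK.comp barK).comp (algebraMap (Polynomial ℚ) K)).comp
          Polynomial.C) (((RingHom.id K).comp (algebraMap (Polynomial ℚ) K)).comp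
          Polynomial.C))) a
    · have hX : algebraMap (Polynomial ℚ) K Polynomial.X = q := RatFunc.algebraMap_X
      simp [hX, barK_q]
  exact congrFun (congrArg DFunLike.coe h) c

lemma bar_bar (x : O n) : bar (bar x) = x := by
  let f : O n →ₐ[K] O n :=
    { toFun := fun x => bar (bar x)
      map_one' := by rw [bar_one, bar_one]
      map_mul' := fun x y => by rw [bar_mul, bar_mul]
      map_zero' := by simp [bar]
      map_add' := fun x y => by rw [bar_add, bar_add]
      commutes' := fun c => by
        rw [Algebra.algebraMap_eq_smul_one, bar_smul, bar_smul, barK_barK, bar_one, bar_one] }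
  have h : f = AlgHom.id K (O n) := algHom_ext fun i j => by
    change bar (bar (Z i j)) = Z i j
    rw [bar_Z, bar_Z]
  exact congrFun (congrArg DFunLike.coe h) x

/-! ### Monomials -/

/-- `n × n` matrices with non-negative integer entries. -/
abbrev Mat (n : ℕ) : Type := Matrix (Fin n) (Fin n) ℕ

/-- The monomial `Z^A = ∏ Z_{ij}^{a_{ij}}`, with the factors in the lexicographic order of the
pairs `(i, j)`. -/
def monomial (A : Mat n) : O n :=
  ((List.finRange n).map fun i => ((List.finRange n).map fun j => Z i j ^ A i j).prod).prod

/-- The row sums `ro(A)`. -/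
def ro (A : Mat n) : Fin n → ℕ := fun i => ∑ j, A i j

/-- The column sums `co(A)`. -/
def co (A : Mat n) : Fin n → ℕ := fun j => ∑ i, A i j

/-- The number `∑_i ∑_{j > k} a_{ij} a_{ik} + ∑_i ∑_{j > k} a_{ji} a_{ki}`. -/
def dExp (A : Mat n) : ℕ :=
  (∑ i, ∑ j, ∑ k, if k < j then A i j * A i k else 0) +
    ∑ i, ∑ j, ∑ k, if k < j then A j i * A k i else 0

/-- The normalized monomial `Z(A) = D(A) Z^A`, where `D(A) = q ^ (- dExp A)`. -/
def normMonomial (A : Mat n) : O n := (q ^ (-(dExp A : ℤ))) • monomial A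

/-- The strict lexicographic order on matrices: `B < A` if at the first place `(i, j)`, in the
lexicographic order of the pairs, at which `B` and `A` differ, the entry of `B` is the smaller
one. -/
def LexLT (B A : Mat n) : Prop :=
  ∃ i j, (∀ s t, (s < i ∨ (s = i ∧ t < j)) → B s t = A s t) ∧ B i j < A i j

/-! ### The lattice and its basis -/

/-- The evaluation `p ↦ p(q)` of integral polynomials in `K`. -/
def evalq : Polynomial ℤ →+* K := Polynomial.eval₂RingHom (Int.castRingHom K) q

/-- The subring `ℤ[q]` of `K`. -/
abbrev Zq : Subring K := evalq.range

/-- The `ℤ[q]`-lattice `L^*` spanned by the normalized monomials `Z(A)`. -/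
def lattice (n : ℕ) : Submodule Zq (O n) :=
  Submodule.span Zq (Set.range (normMonomial (n := n)))

/-- The family `b(A)`, `A ∈ M_n(ℤ_+)`, is a `ℤ[q]`-basis of `L^*` such that every `b(A)` is bar
invariant and `b(A) = Z(A) + ∑_B h_B(A) Z(B)`, where `h_B(A) ∈ q ℤ[q]` and the sum is over
`B < A` with `ro(B) = ro(A)`, `co(B) = co(A)`. -/
structure IsCanonicalFamily (b : Mat n → O n) : Prop where
  linearIndependent : LinearIndependent Zq b
  span_eq : Submodule.span Zq (Set.range b) = lattice n
  bar_eq : ∀ A, bar (b A) = b A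
  expansion : ∀ A, ∃ h : Mat n →₀ Polynomial ℤ,
    (∀ B ∈ h.support, LexLT B A ∧ ro B = ro A ∧ co B = co A ∧ Polynomial.X ∣ h B) ∧
    b A = normMonomial A + h.sum fun B p => evalq p • normMonomial B

end

end QuantumMatrix

set_option linter.unusedSimpArgs false

namespace QuantumMatrix

noncomputable section


-- The family `b` comes from a Kazhdan–Lusztig type argument. The bar map is unitriangular on the
-- `Z(A)` with coefficients in `ℤ[q, q⁻¹]`, and only finitely many matrices share given row and
-- column sums. Hence the antisymmetric element `bar Z(A) - Z(A)` can be written as `y - bar y` with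
-- `y` supported below `A` and coefficients in `qℤ[q]`, and `Z(A) + y` is the required element.
-- Conversely, a bar-invariant combination of the `Z(B)` with coefficients in `qℤ[q]` vanishes,
-- since its coefficient at a maximal `B` is fixed by `q ↦ q⁻¹`.
--
-- This last fact holds on all matrices with given row and column sums, so uniqueness needs only
-- congruence to `Z(A)` modulo `q`, not the lexicographic order (`eq_of_bar_eq`). That is what makes
-- `σ` work although transposition need not respect the order. `σ` commutes with bar and sends
-- `Z(A)` to `Z(Aᵀ)`, because passing from column reading to row reading only exchanges commuting
-- generators. So `σ(b(A))` is bar invariant and congruent to `Z(Aᵀ)`, hence equals `b(Aᵀ)`.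
--
-- Two inputs carry the weight. Triangularity (`bar_normMonomial_sub_mem`): words are scaled so that
-- permuting letters changes them only by lexicographically lower words, and bar reverses a scaled
-- word. Independence of the `Z(A)` (`linearIndependent_normMonomial`): a representation is built
-- one row at a time, in which ordered monomials send a vacuum vector to independent vectors.

/- The default instances, which come from the polynomial ring, do not unify with the ones
expected by `module`. -/
instance natAlgebra : Algebra ℕ K := Semiring.toNatAlgebra

instance intAlgebra : Algebra ℤ K := Ring.toIntAlgebra K

/-- The coefficient `q² - q⁻²` of the diagonal relation. -/
def lam : K := q ^ 2 - (q⁻¹) ^ 2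

/-- The sum of the entries of `α` at the places before `j`. -/
def prefixSum {n : ℕ} (α : Fin n → ℕ) (j : Fin n) : ℕ := ∑ l, if l < j then α l else 0

lemma prefixSum_add_single {n : ℕ} (α : Fin n → ℕ) (j k : Fin n) :
    prefixSum (α + Pi.single k 1) j = prefixSum α j + if k < j then 1 else 0 := by
  have h : ∀ l : Fin n, (if l < j then (α + Pi.single k 1 : Fin n → ℕ) l else 0) =
      (if l < j then α l else 0) + if l = k then (if k < j then 1 else 0) else 0 := by
    intro l
    by_cases hl : l = k
    · subst hl; by_cases h : l < j <;> simp [h]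
    · simp [hl]
  simp only [prefixSum, h, Finset.sum_add_distrib, Finset.sum_ite_eq', Finset.mem_univ, if_true]

/-- The defining relations of quantum matrices, in `R`-matrix form, for a rectangular family of
operators. -/
def IsQuantumMatrix {m n : ℕ} {V : Type} [AddCommGroup V] [Module K V]
    (T : Fin m → Fin n → V →ₗ[K] V) : Prop :=
  ∀ i s j t v, (if i = s then q ^ 2 else 1) • T i j (T s t v) +
      (if s < i then lam else 0) • T s j (T i t v) =
    (if j = t then q ^ 2 else 1) • T s t (T i j v) + (if j < t then lam else 0) • T s j (T i t v)

/-! ### Adding one row: operators on quantum affine space -/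

section Fock

variable {n : ℕ} {V : Type} [AddCommGroup V] [Module K V]

/-- Left multiplication by the `k`-th generator on the quantum affine space with coefficients
in `V`. -/
def raise (V : Type) [AddCommGroup V] [Module K V] (k : Fin n) :
    ((Fin n → ℕ) →₀ V) →ₗ[K] ((Fin n → ℕ) →₀ V) :=
  Finsupp.lsum K fun α => (q ^ (-2 * (prefixSum α k : ℤ))) • Finsupp.lsingle (α + Pi.single k 1)

lemma raise_single (k : Fin n) (α : Fin n → ℕ) (v : V) :
    raise V k (Finsupp.single α v) =
      Finsupp.single (α + Pi.single k 1) ((q ^ (-2 * (prefixSum α k : ℤ))) • v) := by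
  simp [raise]

/-- The coefficients of the action of the lower rows on the quantum affine space. -/
def braidCoeff (t u : Fin n) (α : Fin n → ℕ) : K :=
  if u = t then q ^ (-2 * (α t : ℤ))
  else if u < t then -q ^ 2 * (1 - q ^ (-4 * (α u : ℤ))) *
    q ^ (-2 * ((prefixSum α t : ℤ) - prefixSum α u - α u))
  else 0

/-- The action of the `t`-th entry of a lower row, where `T` is the action of that row on `V`. -/
def lower (T : Fin n → V →ₗ[K] V) (t : Fin n) :
    ((Fin n → ℕ) →₀ V) →ₗ[K] ((Fin n → ℕ) →₀ V) :=
  Finsupp.lsum K fun α => ∑ u, braidCoeff t u α •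
    (Finsupp.lsingle (α + Pi.single t 1 - Pi.single u 1) ∘ₗ T u)

lemma lower_single (T : Fin n → V →ₗ[K] V) (t : Fin n) (α : Fin n → ℕ) (v : V) :
    lower T t (Finsupp.single α v) = ∑ u,
      Finsupp.single (α + Pi.single t 1 - Pi.single u 1) (braidCoeff t u α • T u v) := by
  simp [lower]

lemma braidCoeff_zero (t u : Fin n) : braidCoeff t u 0 = if u = t then 1 else 0 := by
  simp [braidCoeff]

lemma lower_single_zero (T : Fin n → V →ₗ[K] V) (t : Fin n) (v : V) :
    lower T t (Finsupp.single 0 v) = Finsupp.single 0 (T t v) := by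
  rw [lower_single, Finset.sum_eq_single t]
  · simp [braidCoeff_zero]
  · intro u _ hu
    simp [braidCoeff_zero, hu]
  · simp

/-- The termwise form of `lower_raise`. -/
lemma lower_raise_term (t k u : Fin n) (α : Fin n → ℕ) (w : V) :
    Finsupp.single (α + Pi.single k 1 + Pi.single t 1 - Pi.single u 1)
        ((q ^ (-2 * (prefixSum α k : ℤ)) * braidCoeff t u (α + Pi.single k 1)) • w) =
      (if t = k then (q⁻¹) ^ 2 else 1) •
        Finsupp.single (α + Pi.single t 1 - Pi.single u 1 + Pi.single k 1)
        ((q ^ (-2 * (prefixSum (α + Pi.single t 1 - Pi.single u 1) k : ℤ)) *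
          braidCoeff t u α) • w) -
      (if k < t then lam else 0) •
        Finsupp.single (α + Pi.single k 1 - Pi.single u 1 + Pi.single t 1)
        ((q ^ (-2 * (prefixSum (α + Pi.single k 1 - Pi.single u 1) t : ℤ)) *
          braidCoeff k u α) • w) := by
  rcases lt_trichotomy u t with hut | rfl | hut
  -- Subtraction of exponents truncates when `α u = 0`, but then the factor `1 - q ^ (-4 * α u)`
  -- kills the term. Only `k = u` survives, where the raised exponent is 1.
  · rcases Nat.eq_zero_or_pos (α u) with hu | hu
    · by_cases hk : k = u
      · subst hk
        have h1 : α + Pi.single k 1 + Pi.single t 1 - Pi.single k 1 = α + Pi.single t 1 := by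
          rw [add_right_comm, add_tsub_cancel_right]
        simp [braidCoeff, hut, hut.ne, hut.ne', hu, h1, prefixSum_add_single, ← Finsupp.single_neg,
          smul_smul, ← neg_smul]
        congr 2
        have hq := q_ne_zero
        simp only [mul_add, mul_sub, mul_one, zpow_add₀ hq, zpow_sub₀ hq, zpow_mul', zpow_ofNat, lam]
        field_simp
      · simp [braidCoeff, hut, hut.ne, hut.ne', hu, hk, Ne.symm hk]
    · obtain ⟨β, rfl⟩ : ∃ β : Fin n → ℕ, α = β + Pi.single u 1 := by
        refine ⟨α - Pi.single u 1, (tsub_add_cancel_of_le ?_).symm⟩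
        intro l
        by_cases hl : l = u
        · subst hl; simpa [Nat.one_le_iff_ne_zero] using hu.ne'
        · simp [hl]
      have h1 : ∀ k t : Fin n, β + Pi.single u 1 + Pi.single k 1 + Pi.single t 1 - Pi.single u 1 =
          β + Pi.single k 1 + Pi.single t 1 := fun k t => by
        rw [add_assoc, add_right_comm, add_tsub_cancel_right, add_assoc]
      have h2 : ∀ k : Fin n, β + Pi.single u 1 + Pi.single k 1 - Pi.single u 1 =
          β + Pi.single k 1 := fun k => by
        rw [add_right_comm, add_tsub_cancel_right]
      rw [h1, h2, h2, add_right_comm β (Pi.single t 1), Finsupp.smul_single, Finsupp.smul_single,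
        ← Finsupp.single_sub, smul_smul, smul_smul, ← sub_smul]
      congr 2
      have hq := q_ne_zero
      rcases lt_trichotomy k u with hku | rfl | hku
      · have hkt := hku.trans hut
        simp [braidCoeff, hut, hut.ne, hut.ne', prefixSum_add_single, hku, hku.ne, hku.ne', hku.not_gt,
          hut.not_gt, hkt, hkt.ne, hkt.ne', hkt.not_gt]
      · simp [braidCoeff, hut, hut.ne, hut.ne', prefixSum_add_single, hut.not_gt, lam]
        simp only [mul_add, mul_sub, mul_one, zpow_add₀ hq, zpow_sub₀ hq, zpow_neg, zpow_mul',
          zpow_ofNat]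
        field_simp
        ring
      · rcases lt_trichotomy k t with hkt | rfl | hkt
        · simp [braidCoeff, hut, hut.ne, hut.ne', prefixSum_add_single, hku, hku.ne, hku.ne', hku.not_gt,
            hut.not_gt, hkt, hkt.ne, hkt.ne', hkt.not_gt, lam]
          simp only [mul_add, mul_sub, mul_one, zpow_add₀ hq, zpow_sub₀ hq, zpow_neg, zpow_mul',
            zpow_ofNat]
          field_simp
          ring
        · simp [braidCoeff, hut, hut.ne, hut.ne', prefixSum_add_single, hut.not_gt, lam]
          simp only [mul_add, mul_sub, mul_one, zpow_add₀ hq, zpow_sub₀ hq, zpow_neg, zpow_mul',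
            zpow_ofNat]
          field_simp
        · simp [braidCoeff, hut, hut.ne, hut.ne', prefixSum_add_single, hku, hku.ne, hku.ne', hku.not_gt,
            hut.not_gt, hkt, hkt.ne, hkt.ne', hkt.not_gt, lam]
  · have h1 : α + Pi.single k 1 + Pi.single u 1 - Pi.single u 1 = α + Pi.single k 1 := by
      rw [add_tsub_cancel_right]
    by_cases hk : u = k
    · subst hk
      simp [braidCoeff, smul_smul, add_tsub_cancel_right]
      congr 2
      have hq := q_ne_zero
      simp only [mul_add, mul_sub, mul_one, zpow_add₀ hq, zpow_sub₀ hq, zpow_mul', zpow_ofNat]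
      field_simp
    · by_cases hk' : k < u
      · simp [braidCoeff, hk, hk'.not_gt, hk', h1, add_tsub_cancel_right]
      · simp [braidCoeff, hk, hk', h1, add_tsub_cancel_right]
  · have h : ¬ u < t := hut.not_gt
    by_cases hk : k < t
    · simp [braidCoeff, h, hut.ne', hk, (hk.trans hut).ne', (hk.trans hut).not_gt]
    · simp [braidCoeff, h, hut.ne', hk]

/-- These are the relations between the new top row and a row below it, solved for the product with
the lower row on the left. They involve one entry of each row, so nothing is required of `T`.
Together with the action on the vacuum they determine `lower`, and `braidCoeff` is the resulting
closed form. -/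
lemma lower_raise (T : Fin n → V →ₗ[K] V) (t k : Fin n) (f : (Fin n → ℕ) →₀ V) :
    lower T t (raise V k f) = (if t = k then (q⁻¹) ^ 2 else 1) • raise V k (lower T t f) -
      (if k < t then lam else 0) • raise V t (lower T k f) := by
  induction f using Finsupp.induction_linear with
  | zero => simp
  | add f g hf hg => simp only [map_add, hf, hg, smul_add]; abel
  | single α v =>
    simp only [raise_single, lower_single, map_sum, Finset.smul_sum, ← Finset.sum_sub_distrib]
    refine Finset.sum_congr rfl fun u _ => ?_
    simp only [map_smul, smul_smul]
    rw [mul_comm, lower_raise_term]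

lemma raise_raise (j k : Fin n) (hjk : j < k) (f : (Fin n → ℕ) →₀ V) :
    raise V j (raise V k f) = (q ^ 2) • raise V k (raise V j f) := by
  induction f using Finsupp.induction_linear with
  | zero => simp
  | add f g hf hg => simp only [map_add, hf, hg, smul_add]
  | single α v =>
    simp only [raise_single, smul_smul, Finsupp.smul_single, prefixSum_add_single, hjk, hjk.not_gt,
      if_true, if_false]
    rw [add_right_comm]
    congr 2
    push_cast
    rw [← mul_assoc, ← zpow_natCast q 2, ← zpow_add₀ q_ne_zero, ← zpow_add₀ q_ne_zero,
      ← zpow_add₀ q_ne_zero]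
    congr 1
    push_cast
    ring

lemma exists_add_single {α : Fin n → ℕ} (hα : α ≠ 0) :
    ∃ (k : Fin n) (β : Fin n → ℕ), α = β + Pi.single k 1 := by
  obtain ⟨k, hk⟩ := Function.ne_iff.mp hα
  refine ⟨k, α - Pi.single k 1, (tsub_add_cancel_of_le ?_).symm⟩
  intro l
  by_cases hl : l = k
  · subst hl; simpa [Nat.one_le_iff_ne_zero] using hk
  · simp [hl]

/-- An induction principle: a property of vectors that is additive, holds on the vacuum, and is
preserved by the raising operators, holds everywhere. -/
lemma raise_induction {P : ((Fin n → ℕ) →₀ V) → Prop} (h0 : ∀ v, P (Finsupp.single 0 v))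
    (hadd : ∀ f g, P f → P g → P (f + g)) (hraise : ∀ k f, P f → P (raise V k f))
    (f : (Fin n → ℕ) →₀ V) : P f := by
  have key : ∀ (N : ℕ) (α : Fin n → ℕ), ∑ l, α l = N → ∀ v, P (Finsupp.single α v) := by
    intro N
    induction N with
    | zero =>
      intro α hα v
      have : α = 0 := by
        funext l
        exact (Finset.sum_eq_zero_iff.mp hα) l (Finset.mem_univ l)
      rw [this]; exact h0 v
    | succ N ih =>
      intro α hα v
      have hne : α ≠ 0 := by
        rintro rfl
        simp at hα
      obtain ⟨k, β, rfl⟩ := exists_add_single hne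
      have hβ : ∑ l, β l = N := by
        simpa [Finset.sum_add_distrib] using hα
      have h := hraise k _ (ih β hβ ((q ^ (-2 * (prefixSum β k : ℤ)))⁻¹ • v))
      rwa [raise_single, smul_smul, mul_inv_cancel₀ (zpow_ne_zero _ q_ne_zero), one_smul] at h
  induction f using Finsupp.induction_linear with
  | zero => simpa using h0 0
  | add f g hf hg => exact hadd f g hf hg
  | single α v => exact key _ α rfl v

/-- Commuting the raising operator to the left turns the relation on `raise V k f` into raised
relations on `f`. The constants `c₁`, `c₂` stand for the coefficients that depend on the rows only,
so all row positions are treated at once and just the order of the columns `j`, `t`, `k` matters. -/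
lemma lower_relation_raise {A B : Fin n → V →ₗ[K] V} {c₁ c₂ : K} {f : (Fin n → ℕ) →₀ V}
    (h : ∀ j t, c₁ • lower A j (lower B t f) + c₂ • lower B j (lower A t f) =
      (if j = t then q ^ 2 else 1) • lower B t (lower A j f) +
        (if j < t then lam else 0) • lower B j (lower A t f)) (k j t : Fin n) :
    c₁ • lower A j (lower B t (raise V k f)) + c₂ • lower B j (lower A t (raise V k f)) =
      (if j = t then q ^ 2 else 1) • lower B t (lower A j (raise V k f)) +
        (if j < t then lam else 0) • lower B j (lower A t (raise V k f)) := by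
  have H : ∀ l j t, c₁ • raise V l (lower A j (lower B t f)) +
      c₂ • raise V l (lower B j (lower A t f)) =
      (if j = t then q ^ 2 else 1) • raise V l (lower B t (lower A j f)) +
        (if j < t then lam else 0) • raise V l (lower B j (lower A t f)) := by
    intro l j t
    simpa only [map_add, map_smul] using congrArg (raise V l) (h j t)
  simp only [lower_raise, map_sub, map_smul]
  have hq := q_ne_zero
  -- Each passage through `lower_raise` may trade the raised column `k` for `j` or `t`. These are
  -- the placements that occur; the combinations below weight them by the exchange coefficients.
  have h1 := H k j t
  have h2 := H j k t
  have h3 := H t j k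
  have h4 := H j t k
  have e : lam = q ^ 2 - (q⁻¹) ^ 2 := rfl
  rcases lt_trichotomy j t with hjt | rfl | hjt
  · rcases lt_trichotomy k j with hkj | rfl | hkj
    · have hkt := hkj.trans hjt
      simp only [hjt, hkj, hkt, hjt.ne, hkj.ne, hkt.ne, hjt.ne', hkj.ne', hkt.ne', hjt.not_gt,
        hkj.not_gt, hkt.not_gt, if_true, if_false] at *
      linear_combination (norm := skip) h1 - lam • h2 - lam • h3
      simp only [e]; match_scalars <;> field_simp <;> ring
    · simp only [hjt, hjt.ne, hjt.ne', hjt.not_gt, lt_irrefl, if_true, if_false] at *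
      linear_combination (norm := skip) (q⁻¹) ^ 2 • h1 - lam • h3
      simp only [e]; match_scalars <;> field_simp <;> ring
    · rcases lt_trichotomy k t with hkt | rfl | hkt
      · simp only [hjt, hkj, hkt, hjt.ne, hkj.ne, hkt.ne, hjt.ne', hkj.ne', hkt.ne', hjt.not_gt,
          hkj.not_gt, hkt.not_gt, if_true, if_false] at *
        linear_combination (norm := skip) h1 - lam • h3
        simp only [e]; match_scalars <;> field_simp <;> ring
      · simp only [hjt, hjt.ne, hjt.ne', hjt.not_gt, lt_irrefl, if_true, if_false] at *
        linear_combination (norm := skip) (q⁻¹) ^ 2 • h1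
        simp only [e]; match_scalars <;> field_simp <;> ring
      · simp only [hjt, hkj, hkt, hjt.ne, hkj.ne, hkt.ne, hjt.ne', hkj.ne', hkt.ne', hjt.not_gt,
          hkj.not_gt, hkt.not_gt, if_true, if_false] at *
        linear_combination (norm := skip) h1
        simp only [e]; match_scalars <;> field_simp <;> ring
  · rcases lt_trichotomy k j with hkj | rfl | hkj
    · simp only [hkj, hkj.ne, hkj.ne', hkj.not_gt, lt_irrefl, if_true, if_false] at *
      linear_combination (norm := skip) h1 - lam • h2 - (lam * (q⁻¹) ^ 2) • h3
      simp only [e]; match_scalars <;> field_simp <;> ring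
    · simp only [lt_irrefl, if_true, if_false] at *
      linear_combination (norm := skip) ((q⁻¹) ^ 2 * (q⁻¹) ^ 2) • h1
      match_scalars <;> field_simp <;> ring
    · simp only [hkj, hkj.ne, hkj.ne', hkj.not_gt, lt_irrefl, if_true, if_false] at *
      linear_combination (norm := skip) h1
      match_scalars <;> field_simp <;> ring
  · rcases lt_trichotomy k t with hkt | rfl | hkt
    · have hkj := hkt.trans hjt
      simp only [hjt, hkj, hkt, hjt.ne, hkj.ne, hkt.ne, hjt.ne', hkj.ne', hkt.ne', hjt.not_gt,
        hkj.not_gt, hkt.not_gt, if_true, if_false] at *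
      linear_combination (norm := skip) h1 - lam • h2 - lam • h3 + (lam * lam) • h4
      simp only [e]; match_scalars <;> field_simp <;> ring
    · simp only [hjt, hjt.ne, hjt.ne', hjt.not_gt, lt_irrefl, if_true, if_false] at *
      linear_combination (norm := skip) (q⁻¹) ^ 2 • h1 - ((q⁻¹) ^ 2 * lam) • h2
      simp only [e]; match_scalars <;> field_simp <;> ring
    · rcases lt_trichotomy k j with hkj | rfl | hkj
      · simp only [hjt, hkj, hkt, hjt.ne, hkj.ne, hkt.ne, hjt.ne', hkj.ne', hkt.ne', hjt.not_gt,
          hkj.not_gt, hkt.not_gt, if_true, if_false] at *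
        linear_combination (norm := skip) h1 - lam • h2
        simp only [e]; match_scalars <;> field_simp <;> ring
      · simp only [hjt, hjt.ne, hjt.ne', hjt.not_gt, lt_irrefl, if_true, if_false] at *
        linear_combination (norm := skip) (q⁻¹) ^ 2 • h1
        simp only [e]; match_scalars <;> field_simp <;> ring
      · simp only [hjt, hkj, hkt, hjt.ne, hkj.ne, hkt.ne, hjt.ne', hkj.ne', hkt.ne', hjt.not_gt,
          hkj.not_gt, hkt.not_gt, if_true, if_false] at *
        linear_combination (norm := skip) h1
        simp only [e]; match_scalars <;> field_simp <;> ring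

/-- The operators on the quantum affine space with coefficients in `V` given by one more row. -/
def fockMatrix {m : ℕ} (T : Fin m → Fin n → V →ₗ[K] V) (i : Fin (m + 1)) (j : Fin n) :
    ((Fin n → ℕ) →₀ V) →ₗ[K] ((Fin n → ℕ) →₀ V) :=
  Fin.cases (motive := fun _ => ((Fin n → ℕ) →₀ V) →ₗ[K] ((Fin n → ℕ) →₀ V)) (raise V j)
    (fun s => lower (T s) j) i

@[simp] lemma fockMatrix_zero {m : ℕ} (T : Fin m → Fin n → V →ₗ[K] V) (j : Fin n) :
    fockMatrix T 0 j = raise V j := rfl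

@[simp] lemma fockMatrix_succ {m : ℕ} (T : Fin m → Fin n → V →ₗ[K] V) (s : Fin m) (j : Fin n) :
    fockMatrix T s.succ j = lower (T s) j := rfl

/-- Relations that involve the top row are `raise_raise` and `lower_raise`. Those among lower rows
hold on the vacuum by `hT` and spread by `raise_induction`. -/
lemma IsQuantumMatrix.fockMatrix {m : ℕ} {T : Fin m → Fin n → V →ₗ[K] V}
    (hT : IsQuantumMatrix T) : IsQuantumMatrix (fockMatrix T) := by
  intro i s j t f
  have hq := q_ne_zero
  have e : lam = q ^ 2 - (q⁻¹) ^ 2 := rfl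
  induction i using Fin.cases with
  | zero =>
    induction s using Fin.cases with
    | zero =>
      simp only [fockMatrix_zero, lt_irrefl, if_true, if_false]
      rcases lt_trichotomy j t with h | rfl | h
      · simp only [h, h.ne, if_true, if_false, raise_raise j t h, e]
        match_scalars
        field_simp
        ring
      · simp
      · simp only [h.not_gt, h.ne', if_false, raise_raise t j h]
        module
    | succ s =>
      simp only [fockMatrix_zero, fockMatrix_succ, (Fin.succ_ne_zero s).symm, if_false,
        Fin.not_lt_zero, lower_raise]
      rcases lt_trichotomy j t with h | rfl | h
      · simp only [h, h.ne, h.ne', h.not_gt, if_true, if_false]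
        module
      · simp only [lt_irrefl, if_true, if_false]
        match_scalars
        field_simp
        ring
      · simp only [h.not_gt, h.ne', h.ne, if_false]
        module
  | succ i =>
    induction s using Fin.cases with
    | zero =>
      simp only [fockMatrix_zero, fockMatrix_succ, Fin.succ_ne_zero, if_false,
        Fin.succ_pos, if_true, lower_raise]
      rcases lt_trichotomy j t with h | rfl | h
      · simp only [h, h.ne, h.not_gt, if_true, if_false]
        module
      · simp only [lt_irrefl, if_true, if_false, e]
        match_scalars
        field_simp
        ring
      · simp only [h, h.not_gt, h.ne', if_false, if_true]
        module
    | succ s =>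
      simp only [fockMatrix_succ, Fin.succ_inj, Fin.succ_lt_succ_iff]
      revert j t
      induction f using raise_induction with
      | h0 v =>
        intro j t
        simp only [lower_single_zero, Finsupp.smul_single, ← Finsupp.single_add, hT i s j t v]
      | hadd f g hf hg =>
        intro j t
        simp only [map_add, smul_add]
        linear_combination (norm := module) hf j t + hg j t
      | hraise k f hf =>
        intro j t
        exact lower_relation_raise hf k j t

/-- The ordered monomial in the operators `T`. -/
def opMonomial {m : ℕ} (T : Fin m → Fin n → V →ₗ[K] V) (A : Fin m → Fin n → ℕ) :
    Module.End K V :=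
  ((List.finRange m).map fun i =>
    ((List.finRange n).map fun j => (T i j : Module.End K V) ^ A i j).prod).prod

lemma list_prod_single_zero {ι : Type} (l : List ι) (X : ι → Module.End K ((Fin n → ℕ) →₀ V))
    (Y : ι → Module.End K V)
    (h : ∀ i v, X i (Finsupp.single 0 v) = Finsupp.single 0 (Y i v)) (v : V) :
    (l.map X).prod (Finsupp.single 0 v) = Finsupp.single 0 ((l.map Y).prod v) := by
  induction l with
  | nil => simp
  | cons i l ih => simp [ih, h]

lemma pow_single_zero (X : Module.End K ((Fin n → ℕ) →₀ V)) (Y : Module.End K V)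
    (h : ∀ v, X (Finsupp.single 0 v) = Finsupp.single 0 (Y v)) (k : ℕ) (v : V) :
    (X ^ k) (Finsupp.single 0 v) = Finsupp.single 0 ((Y ^ k) v) := by
  induction k with
  | zero => simp
  | succ k ih => rw [pow_succ', pow_succ', Module.End.mul_apply, ih, h, Module.End.mul_apply]

/-- With no exponents before `j` there is nothing to commute past, so no power of `q` appears. -/
lemma raise_pow_single (j : Fin n) (α : Fin n → ℕ) (hα : ∀ l < j, α l = 0) (k : ℕ) (v : V) :
    ((raise V j : Module.End K _) ^ k) (Finsupp.single α v) =
      Finsupp.single (α + Pi.single j k) v := by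
  have h0 : ∀ k : ℕ, prefixSum (α + Pi.single j k) j = 0 := by
    intro k
    refine Finset.sum_eq_zero fun l _ => ?_
    split_ifs with hl
    · simp [hα l hl, hl.ne]
    · rfl
  induction k with
  | zero => simp
  | succ k ih =>
    rw [pow_succ', Module.End.mul_apply, ih, raise_single, h0, add_assoc, ← Pi.single_add]
    simp

/-- The rightmost factor acts first, so columns are filled from the largest index down and
`raise_pow_single` applies each time. -/
lemma prod_raise_pow_single (a : Fin n → ℕ) (v : V) (l : List (Fin n))
    (hl : l.Pairwise (· < ·)) :
    (l.map fun j => (raise V j : Module.End K _) ^ a j).prod (Finsupp.single 0 v) =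
      Finsupp.single (fun j => if j ∈ l then a j else 0) v := by
  induction l with
  | nil =>
    simp only [List.map_nil, List.prod_nil, List.not_mem_nil, if_false]
    rfl
  | cons j l ih =>
    rw [List.pairwise_cons] at hl
    have hj : j ∉ l := fun h => lt_irrefl _ (hl.1 j h)
    rw [List.map_cons, List.prod_cons, Module.End.mul_apply, ih hl.2, raise_pow_single]
    · congr 1
      funext i
      by_cases hi : i = j
      · subst hi; simp [hj]
      · simp [hi]
    · intro i hi
      have : i ∉ l := fun h => lt_asymm hi (hl.1 i h)
      simp [this]

/-- The lower rows act first and, on the vacuum, only through `V`; the top row then records its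
exponents. Thus the first row of `A` can be read off from the degree, which drives the induction on
the number of rows. -/
lemma opMonomial_fockMatrix {m : ℕ} (T : Fin m → Fin n → V →ₗ[K] V)
    (A : Fin (m + 1) → Fin n → ℕ) (v : V) :
    opMonomial (fockMatrix T) A (Finsupp.single 0 v) =
      Finsupp.single (A 0) (opMonomial T (fun i => A i.succ) v) := by
  rw [opMonomial, List.finRange_succ, List.map_cons, List.prod_cons, List.map_map,
    Module.End.mul_apply,
    list_prod_single_zero _ _ (fun i => ((List.finRange n).map fun j =>
      (T i j : Module.End K V) ^ A i.succ j).prod)]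
  · simp only [fockMatrix_zero]
    rw [prod_raise_pow_single _ _ _ (List.pairwise_lt_finRange n)]
    simp only [List.mem_finRange, if_true]
    rfl
  · intro i v
    refine list_prod_single_zero _ _ _ (fun j v => pow_single_zero _ _ (fun v => ?_) _ v) v
    rw [fockMatrix_succ, lower_single_zero]

end Fock

/-- A representation of the quantum matrices by operators with a vector on which the ordered
monomials act independently. -/
lemma exists_isQuantumMatrix_linearIndependent (n m : ℕ) :
    ∃ (V : Type) (_ : AddCommGroup V) (_ : Module K V) (T : Fin m → Fin n → V →ₗ[K] V) (v : V),
      IsQuantumMatrix T ∧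
        LinearIndependent K (fun A : Fin m → Fin n → ℕ => opMonomial T A v) := by
  induction m with
  | zero =>
    refine ⟨K, inferInstance, inferInstance, fun i => i.elim0, 1, fun i => i.elim0, ?_⟩
    rw [linearIndependent_unique_iff]
    simp [opMonomial]
  | succ m ih =>
    obtain ⟨V, _, _, T, v, hT, hv⟩ := ih
    refine ⟨(Fin n → ℕ) →₀ V, inferInstance, inferInstance, fockMatrix T, Finsupp.single 0 v,
      hT.fockMatrix, ?_⟩
    simp only [opMonomial_fockMatrix]
    have h := Finsupp.linearIndependent_single (R := K) (ι := Fin n → ℕ)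
      (fun _ (A : Fin m → Fin n → ℕ) => opMonomial T A v) (fun _ => hv)
    refine h.comp (fun A : Fin (m + 1) → Fin n → ℕ => ⟨A 0, fun i => A i.succ⟩) ?_
    intro A B hAB
    simp only [Sigma.mk.injEq, heq_eq_eq] at hAB
    funext i
    induction i using Fin.cases with
    | zero => exact hAB.1
    | succ i => exact congrFun hAB.2 i

/-! ### Representations of the algebra and independence of ordered monomials -/

section Representation

variable {n : ℕ} {V : Type} [AddCommGroup V] [Module K V] {T : Fin n → Fin n → V →ₗ[K] V}

/-- The representation of `O_q(M(n))` given by a quantum matrix of operators. -/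
def IsQuantumMatrix.rep (hT : IsQuantumMatrix T) : O n →ₐ[K] Module.End K V :=
  lift (FreeAlgebra.lift K fun p : Idx n => (T p.1 p.2 : Module.End K V)) <| by
    have hanti : ∀ i j s t v, s < i → j < t → T i j (T s t v) = T s t (T i j v) := by
      intro i j s t v his hjt
      have h := hT i s j t v
      simpa [his, hjt, his.ne', hjt.ne] using h
    have hq := q_ne_zero
    intro x y h
    refine LinearMap.ext fun v => ?_
    cases h with
    | row i j k hjk =>
      have h := hT i i j k v
      simp only [if_true, lt_irrefl, if_false, hjk, hjk.ne, lam] at h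
      simp only [map_mul, map_smul, FreeAlgebra.lift_ι_apply, Module.End.mul_apply,
        LinearMap.smul_apply]
      -- Collecting the `lam` term, `h` has coefficient `q² - lam = q⁻²` on the left, hence the
      -- factor `q²`.
      linear_combination (norm := skip) (q ^ 2) • h
      match_scalars <;> field_simp <;> ring
    | col i j k hik =>
      have h := hT i k j j v
      simp only [if_true, lt_irrefl, if_false, hik.not_gt, hik.ne] at h
      simp only [map_mul, map_smul, FreeAlgebra.lift_ι_apply, Module.End.mul_apply,
        LinearMap.smul_apply]
      linear_combination (norm := module) h
    | anti i j s t his hjt =>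
      simpa using hanti i j s t v his hjt
    | diag i j s t his hjt =>
      have h := hT i s j t v
      simp only [if_true, if_false, his.not_gt, his.ne, hjt, hjt.ne, lam,
        hanti s j i t v his hjt] at h
      simp only [map_mul, map_smul, map_add, FreeAlgebra.lift_ι_apply, Module.End.mul_apply,
        LinearMap.smul_apply, LinearMap.add_apply]
      linear_combination (norm := module) h

lemma IsQuantumMatrix.rep_Z (hT : IsQuantumMatrix T) (i j : Fin n) : hT.rep (Z i j) = T i j := by
  simp [IsQuantumMatrix.rep, Z, lift_mk]

lemma IsQuantumMatrix.rep_monomial (hT : IsQuantumMatrix T) (A : Mat n) :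
    hT.rep (monomial A) = opMonomial T A := by
  simp [monomial, opMonomial, map_list_prod, Function.comp_def, hT.rep_Z]

end Representation

/-- The normalized ordered monomials are linearly independent. -/
theorem linearIndependent_normMonomial (n : ℕ) :
    LinearIndependent K (normMonomial (n := n)) := by
  obtain ⟨V, _, _, T, v, hT, hv⟩ := exists_isQuantumMatrix_linearIndependent n n
  have h : LinearIndependent K (monomial (n := n)) := by
    refine LinearIndependent.of_comp
      ((LinearMap.applyₗ (R := K) v) ∘ₗ hT.rep.toLinearMap) ?_
    refine (linearIndependent_equiv' (Equiv.refl _) ?_).mp hv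
    funext A
    simp [hT.rep_monomial]
  convert h.units_smul fun A => (Units.mk0 q q_ne_zero) ^ (-(dExp A : ℤ)) using 1
  funext A
  simp [normMonomial, Units.smul_def]


variable {n : ℕ}

/-! ### Integral Laurent polynomials in `q` -/

/-- `q` as a unit. -/
def qUnit : Kˣ := Units.mk0 q q_ne_zero

/-- The subring `ℤ[q, q⁻¹]` of `K`. -/
abbrev Lq : Subring K := (LaurentPolynomial.eval₂ (Int.castRingHom K) qUnit).range

lemma zpow_mem_Lq (k : ℤ) : q ^ k ∈ Lq :=
  ⟨LaurentPolynomial.T k, by simp [qUnit]⟩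

lemma lam_mem_Lq : lam ∈ Lq := by
  have h1 := zpow_mem_Lq 2
  have h2 := zpow_mem_Lq (-2)
  have : lam = q ^ (2 : ℤ) - q ^ (-2 : ℤ) := by
    rw [lam, zpow_neg, inv_pow]; rfl
  rw [this]
  exact Subring.sub_mem _ h1 h2

lemma smul_mem_of_mem_Lq {S : Submodule Lq (O n)} {c : K} (hc : c ∈ Lq) {x : O n} (hx : x ∈ S) :
    c • x ∈ S :=
  S.smul_mem (⟨c, hc⟩ : Lq) hx

/-! ### The order on matrices with given row and column sums -/

/-- `B < A` lexicographically, and `A` and `B` have the same row sums and column sums. -/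
def Prec (B A : Mat n) : Prop := LexLT B A ∧ ro B = ro A ∧ co B = co A

lemma LexLT.trans {A B C : Mat n} (h₁ : LexLT A B) (h₂ : LexLT B C) : LexLT A C := by
  obtain ⟨i, j, hij, h⟩ := h₁
  obtain ⟨s, t, hst, h'⟩ := h₂
  by_cases h1 : i < s ∨ (i = s ∧ j < t)
  · refine ⟨i, j, fun a b hab => (hij a b hab).trans (hst a b ?_), ?_⟩
    · rcases hab with hab | ⟨rfl, hab⟩
      · rcases h1 with h1 | ⟨rfl, h1⟩
        · exact Or.inl (hab.trans h1)
        · exact Or.inl hab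
      · rcases h1 with h1 | ⟨rfl, h1⟩
        · exact Or.inl h1
        · exact Or.inr ⟨rfl, hab.trans h1⟩
    · rwa [← hst i j h1]
  · by_cases h2 : s < i ∨ (s = i ∧ t < j)
    · refine ⟨s, t, fun a b hab => (hij a b ?_).trans (hst a b hab), ?_⟩
      · rcases hab with hab | ⟨rfl, hab⟩
        · rcases h2 with h2 | ⟨rfl, h2⟩
          · exact Or.inl (hab.trans h2)
          · exact Or.inl hab
        · rcases h2 with h2 | ⟨rfl, h2⟩
          · exact Or.inl h2
          · exact Or.inr ⟨rfl, hab.trans h2⟩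
      · rwa [hij s t h2]
    · obtain rfl : i = s := by
        push Not at h1 h2
        exact le_antisymm h2.1 h1.1
      obtain rfl : j = t := by
        push Not at h1 h2
        exact le_antisymm (h2.2 rfl) (h1.2 rfl)
      exact ⟨i, j, fun a b hab => (hij a b hab).trans (hst a b hab), h.trans h'⟩

lemma LexLT.irrefl (A : Mat n) : ¬ LexLT A A := by
  rintro ⟨i, j, -, h⟩
  exact lt_irrefl _ h

lemma ro_add (A B : Mat n) : ro (A + B) = ro A + ro B := by
  funext i; simp [ro, Finset.sum_add_distrib]

lemma co_add (A B : Mat n) : co (A + B) = co A + co B := by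
  funext i; simp [co, Finset.sum_add_distrib]

lemma Prec.trans {A B C : Mat n} (h₁ : Prec A B) (h₂ : Prec B C) : Prec A C :=
  ⟨h₁.1.trans h₂.1, h₁.2.1.trans h₂.2.1, h₁.2.2.trans h₂.2.2⟩

lemma Prec.irrefl (A : Mat n) : ¬ Prec A A := fun h => h.1.irrefl

lemma Prec.add_right {A B : Mat n} (h : Prec B A) (C : Mat n) : Prec (B + C) (A + C) := by
  obtain ⟨⟨i, j, hij, hlt⟩, hr, hc⟩ := h
  refine ⟨⟨i, j, fun s t hst => ?_, ?_⟩, ?_, ?_⟩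
  · simp [hij s t hst]
  · simpa using hlt
  · rw [ro_add, ro_add, hr]
  · rw [co_add, co_add, hc]

/-- Every entry is bounded by its row sum. This finiteness is what makes `rank` a valid measure for
inductions along `Prec`. -/
lemma finite_ro (r : Fin n → ℕ) : {B : Mat n | ro B = r}.Finite := by
  refine (Set.finite_Iic (α := Fin n → Fin n → ℕ) fun i _ => r i).subset ?_
  rintro B rfl i j
  exact Finset.single_le_sum (f := fun j => B i j) (fun _ _ => Nat.zero_le _) (Finset.mem_univ j)

lemma finite_prec (A : Mat n) : {B : Mat n | Prec B A}.Finite :=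
  (finite_ro (ro A)).subset fun _ hB => hB.2.1

/-- The number of matrices below `A`. -/
def rank (A : Mat n) : ℕ := {B : Mat n | Prec B A}.ncard

lemma Prec.rank_lt {A B : Mat n} (h : Prec B A) : rank B < rank A :=
  Set.ncard_lt_ncard ⟨fun _ hC => hC.trans h, fun h' => Prec.irrefl B (h' h)⟩ (finite_prec A)

/-! ### Words in the generators -/

/-- The matrix unit at the place `x`. -/
def unitMat (x : Idx n) : Mat n := fun i j => if x = (i, j) then 1 else 0

/-- The exponent matrix of a word. -/
def content (w : List (Idx n)) : Mat n := fun i j => w.count (i, j)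

lemma content_cons (x : Idx n) (w : List (Idx n)) :
    content (x :: w) = content w + unitMat x := by
  funext i j
  simp [content, unitMat, List.count_cons]

lemma content_perm {w w' : List (Idx n)} (h : w.Perm w') : content w = content w' := by
  funext i j
  exact h.count_eq _

lemma ro_unitMat (x : Idx n) : ro (unitMat x) = Pi.single x.1 1 := by
  funext i
  by_cases h : i = x.1
  · subst h; simp [ro, unitMat, Prod.ext_iff]
  · simp [ro, unitMat, Prod.ext_iff, h, Ne.symm h]

lemma co_unitMat (x : Idx n) : co (unitMat x) = Pi.single x.2 1 := by
  funext i
  by_cases h : i = x.2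
  · subst h; simp [co, unitMat, Prod.ext_iff]
  · simp [co, unitMat, Prod.ext_iff, h, Ne.symm h]

/-- The exchange made by the diagonal relation: of the four corners, `(i, j)` comes first in the
order, and it loses its unit. -/
lemma prec_unitMat {i s j t : Fin n} (his : i < s) (hjt : j < t) :
    Prec (unitMat (i, t) + unitMat (s, j)) (unitMat (i, j) + unitMat (s, t)) := by
  refine ⟨⟨i, j, ?_, ?_⟩, ?_, ?_⟩
  · intro a b hab
    have h1 : ¬ (i = a ∧ j = b) := by
      rintro ⟨rfl, rfl⟩
      simp at hab
    have h2 : ¬ (i = a ∧ t = b) := by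
      rintro ⟨rfl, rfl⟩
      simp [hjt.not_gt] at hab
    have h3 : ¬ (s = a ∧ j = b) := by
      rintro ⟨rfl, rfl⟩
      simp [his.not_gt] at hab
    have h4 : ¬ (s = a ∧ t = b) := by
      rintro ⟨rfl, rfl⟩
      simp [his.not_gt, hjt.not_gt] at hab
    simp [unitMat, h1, h2, h3, h4]
  · simp [unitMat, his.ne', hjt.ne']
  · simp [ro_add, ro_unitMat]
  · simp [co_add, co_unitMat, add_comm]

/-- The product of a word. -/
def wordProd (w : List (Idx n)) : O n := (w.map fun x => Z x.1 x.2).prod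

lemma wordProd_cons (x : Idx n) (w : List (Idx n)) :
    wordProd (x :: w) = Z x.1 x.2 * wordProd w := by
  simp [wordProd]

/-- The antisymmetric sign `-1`, `0`, `1` for `a < b`, `a = b`, `a > b`. -/
def orderSign (a b : Fin n) : ℤ := if a < b then -1 else if b < a then 1 else 0

lemma orderSign_neg (a b : Fin n) : orderSign b a = -orderSign a b := by
  rcases lt_trichotomy a b with h | rfl | h
  · simp [orderSign, h, h.not_gt]
  · simp [orderSign]
  · simp [orderSign, h, h.not_gt]

/-- The exponent of `q` that normalizes the product of two generators. -/
def pairExp (x y : Idx n) : ℤ :=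
  (if x.1 = y.1 then orderSign x.2 y.2 else 0) + if x.2 = y.2 then orderSign x.1 y.1 else 0

lemma pairExp_neg (x y : Idx n) : pairExp y x = -pairExp x y := by
  simp only [pairExp, orderSign_neg x.1, orderSign_neg x.2, eq_comm (a := y.1),
    eq_comm (a := y.2)]
  split_ifs <;> simp [add_comm]

/-- The exponent of `q` that normalizes a word. -/
def wordExp : List (Idx n) → ℤ
  | [] => 0
  | x :: w => (w.map (pairExp x)).sum + wordExp w

/-- The normalized product of a word. -/
def normWord (w : List (Idx n)) : O n := q ^ wordExp w • wordProd w

lemma wordProd_eq_smul (w : List (Idx n)) : wordProd w = q ^ (-wordExp w) • normWord w := by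
  rw [normWord, smul_smul, ← zpow_add₀ q_ne_zero, neg_add_cancel, zpow_zero, one_smul]

/-- The span of the words that are lower than `A`. -/
def wordSpan (A : Mat n) : Submodule Lq (O n) :=
  Submodule.span Lq (wordProd '' {v | Prec (content v) A})

lemma mul_mem_wordSpan (x : Idx n) {A : Mat n} {y : O n} (hy : y ∈ wordSpan A) :
    Z x.1 x.2 * y ∈ wordSpan (A + unitMat x) := by
  induction hy using Submodule.span_induction with
  | mem y hy =>
    obtain ⟨v, hv, rfl⟩ := hy
    refine Submodule.subset_span ⟨x :: v, ?_, wordProd_cons x v⟩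
    rw [Set.mem_ofPred_eq, content_cons]
    exact Prec.add_right hv _
  | zero => simp
  | add y z _ _ hy hz => rw [mul_add]; exact Submodule.add_mem _ hy hz
  | smul c y _ hy =>
    have : Z x.1 x.2 * (c • y) = c • (Z x.1 x.2 * y) := mul_smul_comm (c : K) _ _
    rw [this]
    exact Submodule.smul_mem _ _ hy

/-- Outside diagonal position two generators commute up to `q^{±2}`, and `pairExp` splits this
factor evenly between the two orders. -/
lemma pairExp_smul_comm (x y : Idx n) (h : ¬ (x.1 < y.1 ∧ x.2 < y.2))
    (h' : ¬ (y.1 < x.1 ∧ y.2 < x.2)) :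
    q ^ pairExp x y • (Z x.1 x.2 * Z y.1 y.2) = q ^ pairExp y x • (Z y.1 y.2 * Z x.1 x.2) := by
  obtain ⟨i, j⟩ := x
  obtain ⟨s, t⟩ := y
  have hq := q_ne_zero
  have hq1 : q ^ (-1 : ℤ) * q ^ 2 = q ^ (1 : ℤ) := by
    rw [zpow_neg, zpow_one]
    field_simp
  rw [pairExp_neg (i, j)]
  rcases lt_trichotomy i s with his | rfl | his <;> rcases lt_trichotomy j t with hjt | rfl | hjt
  · exact absurd ⟨his, hjt⟩ h
  · have e : pairExp (i, j) (s, j) = -1 := by simp [pairExp, orderSign, his, his.ne]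
    rw [e, Z_col _ _ _ his, smul_smul, hq1, neg_neg]
  · have e : pairExp (i, j) (s, t) = 0 := by simp [pairExp, his.ne, hjt.ne']
    simp [e, Z_anti s t i j his hjt]
  · have e : pairExp (i, j) (i, t) = -1 := by simp [pairExp, orderSign, hjt, hjt.ne]
    rw [e, Z_row _ _ _ hjt, smul_smul, hq1, neg_neg]
  · have e : pairExp (i, j) (i, j) = 0 := by simp [pairExp, orderSign]
    simp [e]
  · have e : pairExp (i, j) (i, t) = 1 := by
      simp [pairExp, orderSign, hjt, hjt.ne', hjt.not_gt]
    rw [e, Z_row _ _ _ hjt, smul_smul, hq1]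
  · have e : pairExp (i, j) (s, t) = 0 := by simp [pairExp, his.ne', hjt.ne]
    simp [e, Z_anti i j s t his hjt]
  · have e : pairExp (i, j) (s, j) = 1 := by
      simp [pairExp, orderSign, his, his.ne', his.not_gt]
    rw [e, Z_col _ _ _ his, smul_smul, hq1]
  · exact absurd ⟨his, hjt⟩ h'

lemma wordProd_swap_sub_mem (x y : Idx n) (h : x.1 < y.1) (h' : x.2 < y.2) (l : List (Idx n)) :
    wordProd (x :: y :: l) - wordProd (y :: x :: l) ∈ wordSpan (content (x :: y :: l)) := by
  obtain ⟨i, j⟩ := x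
  obtain ⟨s, t⟩ := y
  have e : wordProd ((i, j) :: (s, t) :: l) - wordProd ((s, t) :: (i, j) :: l) =
      lam • wordProd ((i, t) :: (s, j) :: l) := by
    simp only [wordProd_cons, ← mul_assoc, Z_diag i j s t h h', lam, add_mul, add_sub_cancel_left,
      smul_mul_assoc]
  rw [e]
  refine smul_mem_of_mem_Lq lam_mem_Lq (Submodule.subset_span ⟨_, ?_, rfl⟩)
  simp only [Set.mem_ofPred_eq, content_cons]
  have := (prec_unitMat h h').add_right (content l)
  convert this using 1 <;> abel

lemma normWord_swap_sub_mem (x y : Idx n) (l : List (Idx n)) :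
    normWord (x :: y :: l) - normWord (y :: x :: l) ∈ wordSpan (content (x :: y :: l)) := by
  have e : ∀ x y : Idx n, wordExp (x :: y :: l) =
      ((l.map (pairExp x)).sum + (l.map (pairExp y)).sum + wordExp l) + pairExp x y := by
    intro x y
    simp only [wordExp, List.map_cons, List.sum_cons]
    ring
  -- `d` is the part of the exponent that is symmetric in the two letters; a swap affects only their
  -- own pair.
  set d := (l.map (pairExp x)).sum + (l.map (pairExp y)).sum + wordExp l with hd
  have e1 : wordExp (x :: y :: l) = d + pairExp x y := e x y
  have e2 : wordExp (y :: x :: l) = d + pairExp y x := by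
    rw [e y x, hd, add_comm (l.map (pairExp y)).sum]
  simp only [normWord, e1, e2]
  have hp : ∀ x y : Idx n, x.1 < y.1 → x.2 < y.2 → pairExp x y = 0 := by
    intro x y h h'
    simp [pairExp, h.ne, h'.ne]
  by_cases h : x.1 < y.1 ∧ x.2 < y.2
  · rw [pairExp_neg x y, hp x y h.1 h.2, neg_zero, ← smul_sub]
    exact smul_mem_of_mem_Lq (zpow_mem_Lq _) (wordProd_swap_sub_mem x y h.1 h.2 l)
  · by_cases h' : y.1 < x.1 ∧ y.2 < x.2
    · rw [pairExp_neg y x, hp y x h'.1 h'.2, neg_zero, ← smul_sub,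
        content_perm (List.Perm.swap y x l), ← neg_mem_iff, ← smul_neg, neg_sub]
      exact smul_mem_of_mem_Lq (zpow_mem_Lq _) (wordProd_swap_sub_mem y x h'.1 h'.2 l)
    · have : q ^ (d + pairExp x y) • wordProd (x :: y :: l) =
          q ^ (d + pairExp y x) • wordProd (y :: x :: l) := by
        simp only [wordProd_cons, ← mul_assoc, zpow_add₀ q_ne_zero, mul_smul]
        rw [← smul_mul_assoc, pairExp_smul_comm x y h h', smul_mul_assoc]
      rw [this, sub_self]
      exact Submodule.zero_mem _

/-- Normalized words with the same content agree up to lower words. -/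
lemma normWord_sub_mem_of_perm {w w' : List (Idx n)} (h : w.Perm w') :
    normWord w - normWord w' ∈ wordSpan (content w) := by
  induction h with
  | nil => simp
  | @cons x l l' h ih =>
    have e : ∀ l : List (Idx n), normWord (x :: l) =
        q ^ (l.map (pairExp x)).sum • (Z x.1 x.2 * normWord l) := by
      intro l
      rw [normWord, normWord, wordProd_cons, wordExp, zpow_add₀ q_ne_zero, mul_smul,
        mul_smul_comm]
    rw [e, e, (h.map (pairExp x)).sum_eq, ← smul_sub, ← mul_sub, content_cons]
    exact smul_mem_of_mem_Lq (zpow_mem_Lq _) (mul_mem_wordSpan x ih)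
  | swap x y l => exact normWord_swap_sub_mem y x l
  | trans h₁ h₂ ih₁ ih₂ =>
    rw [← content_perm h₁] at ih₂
    simpa using Submodule.add_mem _ ih₁ ih₂

lemma wordExp_append_singleton (w : List (Idx n)) (x : Idx n) :
    wordExp (w ++ [x]) = wordExp w - (w.map (pairExp x)).sum := by
  induction w with
  | nil => simp [wordExp]
  | cons y w ih =>
    simp only [List.cons_append, wordExp, ih, List.map_append, List.map_cons, List.map_nil,
      List.sum_append, List.sum_cons, List.sum_nil, pairExp_neg x y]
    ring

lemma wordExp_reverse (w : List (Idx n)) : wordExp w.reverse = -wordExp w := by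
  induction w with
  | nil => simp [wordExp]
  | cons x w ih =>
    rw [List.reverse_cons, wordExp_append_singleton, ih, wordExp, List.map_reverse,
      List.sum_reverse]
    ring

lemma bar_wordProd (w : List (Idx n)) : bar (wordProd w) = wordProd w.reverse := by
  induction w with
  | nil => simp [wordProd, bar_one]
  | cons x w ih =>
    rw [wordProd_cons, bar_mul, ih, bar_Z]
    simp [wordProd]

/-- Reversal negates `wordExp` because `pairExp` is antisymmetric, and bar inverts `q`; the
normalization is therefore compatible with bar. -/
lemma bar_normWord (w : List (Idx n)) : bar (normWord w) = normWord w.reverse := by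
  rw [normWord, bar_smul, bar_wordProd, normWord, wordExp_reverse, map_zpow₀, barK_q, inv_zpow,
    zpow_neg]


/-! ### The ordered word of a matrix -/

/-- The word of the ordered monomial `Z^A`. -/
def wordOf (A : Mat n) : List (Idx n) :=
  (List.finRange n).flatMap fun i => (List.finRange n).flatMap fun j =>
    List.replicate (A i j) (i, j)

lemma wordProd_flatMap {ι : Type} (l : List ι) (f : ι → List (Idx n)) :
    wordProd (l.flatMap f) = (l.map fun i => wordProd (f i)).prod := by
  induction l with
  | nil => simp [wordProd]
  | cons i l ih =>
    rw [List.flatMap_cons, List.map_cons, List.prod_cons, ← ih]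
    simp [wordProd]

lemma wordProd_wordOf (A : Mat n) : wordProd (wordOf A) = monomial A := by
  simp only [wordOf, wordProd_flatMap, monomial]
  simp [wordProd]

lemma sum_map_flatMap {ι κ : Type} (l : List ι) (f : ι → List κ) (h : κ → ℤ) :
    ((l.flatMap f).map h).sum = (l.map fun i => ((f i).map h).sum).sum := by
  induction l with
  | nil => simp
  | cons i l ih => simp [List.flatMap_cons, ih]

lemma sum_map_wordOf (A : Mat n) (h : Idx n → ℤ) :
    ((wordOf A).map h).sum = ∑ i, ∑ j, (A i j : ℤ) * h (i, j) := by
  simp only [wordOf, sum_map_flatMap, ← List.ofFn_eq_map, List.sum_ofFn]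
  simp

lemma content_wordOf (A : Mat n) : content (wordOf A) = A := by
  funext i j
  have h := sum_map_wordOf A fun x => if x = (i, j) then 1 else 0
  have h' : ∀ w : List (Idx n), (w.map fun x => if x = (i, j) then (1 : ℤ) else 0).sum =
      (w.count (i, j) : ℤ) := by
    intro w
    induction w with
    | nil => simp
    | cons x w ih => simp [List.count_cons, ih, add_comm]
  rw [h'] at h
  have : (((wordOf A).count (i, j) : ℕ) : ℤ) = A i j := by
    rw [h]
    simp [Prod.ext_iff, ite_and]
  exact_mod_cast this

/-- The weak lexicographic order on positions. -/
def IdxLE (x y : Idx n) : Prop := x.1 < y.1 ∨ (x.1 = y.1 ∧ x.2 ≤ y.2)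

lemma pairwise_wordOf (A : Mat n) : (wordOf A).Pairwise IdxLE := by
  rw [wordOf, List.pairwise_flatMap]
  refine ⟨fun i _ => ?_, ?_⟩
  · rw [List.pairwise_flatMap]
    refine ⟨fun j _ => ?_, ?_⟩
    · rw [List.pairwise_replicate]
      exact Or.inr (Or.inr ⟨rfl, le_rfl⟩)
    · refine (List.pairwise_lt_finRange n).imp ?_
      intro j k hjk x hx y hy
      rw [List.eq_of_mem_replicate hx, List.eq_of_mem_replicate hy]
      exact Or.inr ⟨rfl, hjk.le⟩
  · refine (List.pairwise_lt_finRange n).imp ?_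
    intro i k hik x hx y hy
    obtain ⟨j, -, hx⟩ := List.mem_flatMap.mp hx
    obtain ⟨l, -, hy⟩ := List.mem_flatMap.mp hy
    rw [List.eq_of_mem_replicate hx, List.eq_of_mem_replicate hy]
    exact Or.inl hik

/-- The indicator of an ordered pair of distinct positions in one row or one column. -/
def alignedPair (x y : Idx n) : ℤ :=
  (if x.1 = y.1 ∧ x.2 < y.2 then 1 else 0) + if x.2 = y.2 ∧ x.1 < y.1 then 1 else 0

lemma pairExp_of_idxLE {x y : Idx n} (h : IdxLE x y) : pairExp x y = -alignedPair x y := by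
  rcases h with h | ⟨h, h'⟩
  · by_cases hx : x.2 = y.2 <;> simp [pairExp, alignedPair, orderSign, h, h.ne, hx]
  · rcases h'.lt_or_eq with h' | h'
    · simp [pairExp, alignedPair, orderSign, h, h', h'.ne]
    · simp [pairExp, alignedPair, orderSign, h, h']

lemma alignedPair_of_idxLE {x y : Idx n} (h : IdxLE x y) : alignedPair y x = 0 := by
  rcases h with h | ⟨h, h'⟩
  · simp [alignedPair, h.ne', h.not_gt]
  · simp [alignedPair, h, h'.not_gt]

/-- `alignedPair` vanishes on equal letters and on pairs in the wrong order, so in a sorted word the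
sum over earlier-later pairs extends to all pairs. The resulting double sum can be evaluated
entrywise and compared with `dExp`. -/
lemma wordExp_of_pairwise {w : List (Idx n)} (hw : w.Pairwise IdxLE) :
    wordExp w = -(w.map fun x => (w.map (alignedPair x)).sum).sum := by
  induction w with
  | nil => simp [wordExp]
  | cons x w ih =>
    rw [List.pairwise_cons] at hw
    have h1 : (w.map (pairExp x)).sum = -(w.map (alignedPair x)).sum := by
      rw [List.map_congr_left fun y hy => pairExp_of_idxLE (hw.1 y hy)]
      clear ih hw
      induction w with
      | nil => simp
      | cons y w ih => simp only [List.map_cons, List.sum_cons, ih, neg_add]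
    have h2 : (w.map fun y => alignedPair y x + (w.map (alignedPair y)).sum).sum =
        (w.map fun y => (w.map (alignedPair y)).sum).sum := by
      refine congrArg _ (List.map_congr_left fun y hy => ?_)
      rw [alignedPair_of_idxLE (hw.1 y hy), zero_add]
    have h3 : alignedPair x x = 0 := by simp [alignedPair]
    simp only [wordExp, ih hw.2, List.map_cons, List.sum_cons, h1, h2, h3]
    ring

lemma wordExp_wordOf (A : Mat n) : wordExp (wordOf A) = -(dExp A : ℤ) := by
  rw [wordExp_of_pairwise (pairwise_wordOf A), neg_inj]
  simp only [sum_map_wordOf, alignedPair, dExp]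
  push_cast
  simp only [mul_add, Finset.sum_add_distrib]
  congr 1
  · refine Finset.sum_congr rfl fun i _ => ?_
    rw [Finset.sum_comm]
    refine Finset.sum_congr rfl fun j _ => ?_
    rw [Finset.sum_eq_single i (fun s _ hs => by simp [hs.symm]) (by simp), Finset.mul_sum]
    refine Finset.sum_congr rfl fun t _ => ?_
    simp [mul_comm]
  · rw [Finset.sum_comm]
    refine Finset.sum_congr rfl fun j _ => ?_
    rw [Finset.sum_comm]
    refine Finset.sum_congr rfl fun i _ => ?_
    rw [Finset.mul_sum]
    refine Finset.sum_congr rfl fun s _ => ?_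
    rw [Finset.sum_eq_single j (fun t _ ht => by simp [ht.symm]) (by simp)]
    simp [mul_comm]

lemma normMonomial_eq_normWord (A : Mat n) : normMonomial A = normWord (wordOf A) := by
  rw [normWord, wordExp_wordOf, wordProd_wordOf, normMonomial]

/-! ### Triangularity of the bar map -/

/-- The words of content `A` are spanned by the normalized monomials of matrices that are not
higher than `A`. -/
lemma wordProd_mem_span (w : List (Idx n)) :
    wordProd w ∈ Submodule.span Lq
      (normMonomial '' {B | B = content w ∨ Prec B (content w)}) := by
  induction hN : rank (content w) using Nat.strong_induction_on generalizing w with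
  | _ N ih =>
    subst hN
    have hp : w.Perm (wordOf (content w)) := by
      rw [List.perm_iff_count]
      intro x
      exact (congrFun (congrFun (content_wordOf (content w)) x.1) x.2).symm
    have h := normWord_sub_mem_of_perm hp
    rw [← normMonomial_eq_normWord] at h
    have hle : wordSpan (content w) ≤ Submodule.span Lq
        (normMonomial '' {B | B = content w ∨ Prec B (content w)}) := by
      refine Submodule.span_le.mpr ?_
      rintro _ ⟨v, hv, rfl⟩
      refine Submodule.span_mono (Set.image_mono ?_) (ih _ (Prec.rank_lt hv) v rfl)
      rintro B (rfl | hB)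
      · exact Or.inr hv
      · exact Or.inr (hB.trans hv)
    rw [wordProd_eq_smul]
    refine smul_mem_of_mem_Lq (zpow_mem_Lq _) ?_
    rw [← sub_add_cancel (normWord w) (normMonomial (content w))]
    exact Submodule.add_mem _ (hle h) (Submodule.subset_span ⟨_, Or.inl rfl, rfl⟩)

lemma wordSpan_le (A : Mat n) :
    wordSpan A ≤ Submodule.span Lq (normMonomial '' {B | Prec B A}) := by
  refine Submodule.span_le.mpr ?_
  rintro _ ⟨v, hv, rfl⟩
  refine Submodule.span_mono (Set.image_mono ?_) (wordProd_mem_span v)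
  rintro B (rfl | hB)
  · exact hv
  · exact hB.trans hv

/-- The bar map is unitriangular on the normalized monomials. -/
lemma bar_normMonomial_sub_mem (A : Mat n) :
    bar (normMonomial A) - normMonomial A ∈
      Submodule.span Lq (normMonomial '' {B | Prec B A}) := by
  -- By `bar_normWord`, bar of `Z(A)` is the scaled reversed word, a permutation of the ordered one.
  have h := wordSpan_le _ (normWord_sub_mem_of_perm (List.reverse_perm (wordOf A)))
  rwa [content_perm (List.reverse_perm _), content_wordOf, ← bar_normWord,
    ← normMonomial_eq_normWord] at h

/-! ### The transpose automorphism on monomials -/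

lemma prod_map_mul_distrib {ι M : Type} [Monoid M] (l : List ι) (f g : ι → M)
    (h : l.Pairwise fun j k => Commute (g j) (f k)) :
    (l.map fun j => f j * g j).prod = (l.map f).prod * (l.map g).prod := by
  induction l with
  | nil => simp
  | cons j l ih =>
    rw [List.pairwise_cons] at h
    have hc : Commute (g j) (l.map f).prod := by
      refine Commute.list_prod_right _ _ fun x hx => ?_
      obtain ⟨k, hk, rfl⟩ := List.mem_map.mp hx
      exact h.1 k hk
    simp only [List.map_cons, List.prod_cons, ih h.2]
    rw [mul_assoc, ← mul_assoc (g j), hc.eq, mul_assoc, mul_assoc]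

/-- The row and column readings of an array order two entries differently only when they lie in
antidiagonal position. -/
lemma prod_map_prod_map_comm {ι κ M : Type} [Monoid M] [LT ι] [LT κ] (l : List ι) (m : List κ)
    (hl : l.Pairwise (· < ·)) (hm : m.Pairwise (· < ·)) (z : ι → κ → M)
    (h : ∀ i i' j j', i < i' → j' < j → Commute (z i j) (z i' j')) :
    (l.map fun i => (m.map fun j => z i j).prod).prod =
      (m.map fun j => (l.map fun i => z i j).prod).prod := by
  induction l with
  | nil => simp
  | cons i l ih =>
    rw [List.pairwise_cons] at hl
    simp only [List.map_cons, List.prod_cons, ih hl.2]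
    rw [prod_map_mul_distrib]
    refine hm.imp fun {j' j} hj => ?_
    refine (Commute.list_prod_right _ _ fun x hx => ?_).symm
    obtain ⟨i', hi', rfl⟩ := List.mem_map.mp hx
    exact h i i' j j' (hl.1 i' hi') hj

lemma sigma_monomial (A : Mat n) : sigma n (monomial A) = monomial A.transpose := by
  simp only [monomial, map_list_prod, List.map_map, Function.comp_def, map_pow, sigma_Z]
  rw [prod_map_prod_map_comm _ _ (List.pairwise_lt_finRange n) (List.pairwise_lt_finRange n)]
  · rfl
  · intro i i' j j' hi hj
    exact (Commute.pow_pow (Z_anti j i j' i' hj hi) _ _)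

lemma dExp_transpose (A : Mat n) : dExp A.transpose = dExp A := by
  simp only [dExp, Matrix.transpose_apply]
  rw [add_comm]

lemma sigma_normMonomial (A : Mat n) : sigma n (normMonomial A) = normMonomial A.transpose := by
  rw [normMonomial, map_smul, sigma_monomial, normMonomial, dExp_transpose]

/-- In `bar ∘ σ ∘ bar` the two reversals and the two inversions of `q` cancel, leaving a `K`-algebra
homomorphism that agrees with `σ` on generators. -/
lemma bar_sigma (x : O n) : bar (sigma n x) = sigma n (bar x) := by
  let f : O n →ₐ[K] O n :=
    { toFun := fun x => bar (sigma n (bar x))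
      map_one' := by simp [bar_one]
      map_mul' := fun x y => by simp [bar_mul]
      map_zero' := by simp [bar]
      map_add' := fun x y => by simp [bar_add]
      commutes' := fun c => by
        simp [Algebra.algebraMap_eq_smul_one, bar_smul, barK_barK, bar_one] }
  have h : f = (sigma n : O n →ₐ[K] O n) := algHom_ext fun i j => by
    change bar (sigma n (bar (Z i j))) = sigma n (Z i j)
    rw [bar_Z, sigma_Z, bar_Z]
  have h' : bar (sigma n (bar (bar x))) = sigma n (bar x) :=
    congrFun (congrArg DFunLike.coe h) (bar x)
  rwa [bar_bar] at h'


/-! ### Coefficients of Laurent polynomials in `q` -/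

/-- The evaluation of a Laurent polynomial, given by its coefficients, at `q`. -/
def evalLaurent : (ℤ →₀ ℤ) →+ K :=
  Finsupp.liftAddHom fun k => (AddMonoidHom.mulRight (q ^ k)).comp (Int.castAddHom K)

@[simp] lemma evalLaurent_single (k a : ℤ) :
    evalLaurent (Finsupp.single k a) = (a : K) * q ^ k := by
  simp [evalLaurent]

lemma exists_ringHom_laurentSeries (F : Type) [Field F] :
    ∃ φ : RatFunc F →+* HahnSeries ℤ F, φ RatFunc.X = HahnSeries.single 1 1 :=
  ⟨_, RatFunc.coe_X⟩

/-- Coefficients are read off after embedding `K` into the Laurent series over `ℚ`. -/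
lemma exists_coeff (k : ℤ) : ∃ f : K →+ ℚ, ∀ c, f (evalLaurent c) = c k := by
  obtain ⟨φ, hφ⟩ : ∃ φ : K →+* HahnSeries ℤ ℚ, φ q = HahnSeries.single 1 1 :=
    exists_ringHom_laurentSeries ℚ
  refine ⟨(HahnSeries.coeff.addMonoidHom k).comp φ.toAddMonoidHom, fun c => ?_⟩
  induction c using Finsupp.induction_linear with
  | zero => simp
  | add c d hc hd => rw [map_add, map_add, hc, hd, Finsupp.add_apply, Int.cast_add]
  | single m a =>
    have h : φ (q ^ m) = HahnSeries.single m (1 : ℚ) := by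
      rw [map_zpow₀, hφ, ← RatFunc.single_zpow]
    rw [evalLaurent_single, ← zsmul_eq_mul, map_zsmul]
    change a • (φ (q ^ m)).coeff k = _
    rw [h, HahnSeries.coeff_single, Finsupp.single_apply]
    by_cases hk : k = m
    · simp [hk]
    · simp [hk, Ne.symm hk]

lemma evalLaurent_injective : Function.Injective evalLaurent := by
  intro c d h
  ext k
  obtain ⟨f, hf⟩ := exists_coeff k
  have := congrArg f h
  rw [hf, hf] at this
  exact_mod_cast this

lemma barK_evalLaurent (c : ℤ →₀ ℤ) :
    barK (evalLaurent c) = evalLaurent (c.equivMapDomain (Equiv.neg ℤ)) := by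
  induction c using Finsupp.induction_linear with
  | zero => simp
  | add c d hc hd =>
    rw [map_add, map_add, hc, hd, ← map_add]
    congr 1
    ext k
    simp [Finsupp.equivMapDomain_apply]
  | single m a => simp [Finsupp.equivMapDomain_single, barK_q, map_zpow₀]

lemma exists_evalLaurent_of_mem_Lq {r : K} (hr : r ∈ Lq) : ∃ c, evalLaurent c = r := by
  obtain ⟨p, rfl⟩ := hr
  induction p using LaurentPolynomial.induction_on' with
  | add p p' hp hp' =>
    obtain ⟨c, hc⟩ := hp
    obtain ⟨d, hd⟩ := hp'
    exact ⟨c + d, by rw [map_add, map_add, hc, hd]⟩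
  | C_mul_T m a => exact ⟨Finsupp.single m a, by simp [qUnit]⟩

lemma evalLaurent_mem_Lq (c : ℤ →₀ ℤ) : evalLaurent c ∈ Lq := by
  induction c using Finsupp.induction_linear with
  | zero => simp
  | add c d hc hd => rw [map_add]; exact Subring.add_mem _ hc hd
  | single m a =>
    rw [evalLaurent_single]
    exact Subring.mul_mem _ (intCast_mem _ _) (zpow_mem_Lq m)

lemma barK_mem_Lq {r : K} (hr : r ∈ Lq) : barK r ∈ Lq := by
  obtain ⟨c, rfl⟩ := exists_evalLaurent_of_mem_Lq hr
  rw [barK_evalLaurent]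
  exact evalLaurent_mem_Lq _

lemma q_mem_Zq : q ∈ Zq := ⟨Polynomial.X, by simp [evalq]⟩

lemma Zq_le_Lq : Zq ≤ Lq := by
  rintro _ ⟨p, rfl⟩
  induction p using Polynomial.induction_on' with
  | add p p' hp hp' => rw [map_add]; exact Subring.add_mem _ hp hp'
  | monomial m a =>
    have : evalq (Polynomial.monomial m a) = (a : K) * q ^ (m : ℤ) := by simp [evalq]
    rw [this]
    exact Subring.mul_mem _ (intCast_mem _ _) (zpow_mem_Lq m)

lemma exists_evalLaurent_of_mem_Zq {p : K} (hp : p ∈ Zq) :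
    ∃ c, evalLaurent c = q * p ∧ ∀ k ≤ 0, c k = 0 := by
  obtain ⟨p, rfl⟩ := hp
  induction p using Polynomial.induction_on' with
  | add p p' hp hp' =>
    obtain ⟨c, hc, hc'⟩ := hp
    obtain ⟨d, hd, hd'⟩ := hp'
    exact ⟨c + d, by rw [map_add, map_add, hc, hd, mul_add],
      fun k hk => by simp [hc' k hk, hd' k hk]⟩
  | monomial m a =>
    refine ⟨Finsupp.single (m + 1) a, ?_, fun k hk => ?_⟩
    · rw [evalLaurent_single, zpow_add₀ q_ne_zero]
      simp [evalq]
      ring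
    · rw [Finsupp.single_eq_of_ne]
      omega

lemma exists_mem_Zq_of_evalLaurent (c : ℤ →₀ ℤ) (hc : ∀ k ≤ 0, c k = 0) :
    ∃ p ∈ Zq, q * p = evalLaurent c := by
  refine ⟨q⁻¹ * evalLaurent c, ?_, by rw [mul_inv_cancel_left₀ q_ne_zero]⟩
  have e : evalLaurent c = c.sum fun k a => (a : K) * q ^ k := by
    simp [evalLaurent, Finsupp.liftAddHom_apply, Function.comp_def]
  rw [e, Finsupp.sum, Finset.mul_sum]
  refine Subring.sum_mem _ fun k hk => ?_
  have hk' : 0 < k := by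
    by_contra h
    exact (Finsupp.mem_support_iff.mp hk) (hc k (not_lt.mp h))
  obtain ⟨m, rfl⟩ : ∃ m : ℕ, k = m + 1 := ⟨(k - 1).toNat, by omega⟩
  refine ⟨Polynomial.monomial m (c (m + 1)), ?_⟩
  rw [zpow_add₀ q_ne_zero]
  have := q_ne_zero
  simp [evalq]
  field_simp

/-- A bar-antisymmetric Laurent polynomial is `p - p̄` with `p` in `q ℤ[q]`. -/
lemma exists_sub_barK {r : K} (hr : r ∈ Lq) (h : barK r = -r) :
    ∃ p ∈ Zq, q * p - barK (q * p) = r := by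
  obtain ⟨c, rfl⟩ := exists_evalLaurent_of_mem_Lq hr
  rw [barK_evalLaurent, ← map_neg] at h
  have hc : ∀ k, c (-k) = -c k := fun k => by
    simpa [Finsupp.equivMapDomain_apply] using DFunLike.congr_fun (evalLaurent_injective h) k
  -- Antisymmetry gives `c 0 = 0` and makes the negative part minus the mirror image of the positive
  -- part, so the positive part serves as `q * p`.
  obtain ⟨p, hp, hpc⟩ := exists_mem_Zq_of_evalLaurent (c.filter (0 < ·))
    fun k hk => Finsupp.filter_apply_neg _ _ hk.not_gt
  refine ⟨p, hp, ?_⟩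
  rw [hpc, barK_evalLaurent, ← map_sub]
  congr 1
  ext k
  simp only [Finsupp.sub_apply, Finsupp.equivMapDomain_apply, Equiv.neg_symm, Equiv.neg_apply,
    Finsupp.filter_apply, hc]
  rcases lt_trichotomy k 0 with hk | rfl | hk
  · simp [hk, hk.not_gt]
  · have := hc 0
    rw [neg_zero] at this
    simp
    omega
  · simp [hk, hk.not_gt]

/-- A bar-invariant element of `q ℤ[q]` is zero. -/
lemma eq_zero_of_barK_eq {p : K} (hp : p ∈ Zq) (h : barK (q * p) = q * p) : q * p = 0 := by
  obtain ⟨c, hc, hc0⟩ := exists_evalLaurent_of_mem_Zq hp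
  rw [← hc, barK_evalLaurent] at h
  have hs : ∀ k, c (-k) = c k := fun k => by
    simpa [Finsupp.equivMapDomain_apply] using DFunLike.congr_fun (evalLaurent_injective h) k
  -- The coefficients are symmetric under `k ↦ -k` and vanish for `k ≤ 0`.
  have : c = 0 := by
    ext k
    rcases le_or_gt k 0 with hk | hk
    · exact hc0 k hk
    · rw [← hs]
      exact hc0 _ (by omega)
  rw [← hc, this, map_zero]


/-! ### Coordinates with respect to the normalized monomials -/

/-- A left inverse of the linear combination map exists by independence alone; spanning is not
needed. -/
lemma exists_coord (n : ℕ) : ∃ π : O n →ₗ[K] Mat n →₀ K,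
    ∀ A, π (normMonomial A) = Finsupp.single A 1 := by
  obtain ⟨π, hπ⟩ := LinearMap.exists_leftInverse_of_injective
    (Finsupp.linearCombination K (normMonomial (n := n)))
    (LinearMap.ker_eq_bot.mpr (linearIndependent_normMonomial n))
  refine ⟨π, fun A => ?_⟩
  have := LinearMap.congr_fun hπ (Finsupp.single A 1)
  simpa using this

/-- The coordinates with respect to the normalized monomials. -/
def coord (n : ℕ) : O n →ₗ[K] Mat n →₀ K := (exists_coord n).choose

lemma coord_normMonomial (A : Mat n) : coord n (normMonomial A) = Finsupp.single A 1 :=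
  (exists_coord n).choose_spec A

lemma coord_apply_eq_zero {S : Set (Mat n)} {A : Mat n} (hA : A ∉ S) {x : O n}
    (hx : x ∈ Submodule.span K (normMonomial '' S)) : coord n x A = 0 := by
  induction hx using Submodule.span_induction with
  | mem x hx =>
    obtain ⟨B, hB, rfl⟩ := hx
    rw [coord_normMonomial, Finsupp.single_eq_of_ne]
    rintro rfl
    exact hA hB
  | zero => simp
  | add x y _ _ hx hy => rw [map_add, Finsupp.add_apply, hx, hy, add_zero]
  | smul c x _ hx => rw [map_smul, Finsupp.smul_apply, hx, smul_zero]

lemma span_Lq_le {s : Set (O n)} {x : O n} (hx : x ∈ Submodule.span Lq s) :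
    x ∈ Submodule.span K s := by
  induction hx using Submodule.span_induction with
  | mem x hx => exact Submodule.subset_span hx
  | zero => exact Submodule.zero_mem _
  | add x y _ _ hx hy => exact Submodule.add_mem _ hx hy
  | smul c x _ hx => exact Submodule.smul_mem _ (c : K) hx

lemma span_Zq_le {S : Set (Mat n)} {x : O n}
    (hx : x ∈ Submodule.span Zq ((fun A => q • normMonomial A) '' S)) :
    x ∈ Submodule.span K (normMonomial '' S) := by
  induction hx using Submodule.span_induction with
  | mem x hx =>
    obtain ⟨B, hB, rfl⟩ := hx
    exact Submodule.smul_mem _ q (Submodule.subset_span ⟨B, hB, rfl⟩)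
  | zero => exact Submodule.zero_mem _
  | add x y _ _ hx hy => exact Submodule.add_mem _ hx hy
  | smul c x _ hx => exact Submodule.smul_mem _ (c : K) hx

/-! ### Bar-invariant elements supported on lower sets -/

/-- Closure under passing to lower matrices. -/
def IsLower (T : Finset (Mat n)) : Prop := ∀ A ∈ T, ∀ B, Prec B A → B ∈ T

lemma IsLower.bar_mem_span {T : Finset (Mat n)} (hT : IsLower T) {x : O n}
    (hx : x ∈ Submodule.span K (normMonomial '' (T : Set (Mat n)))) :
    bar x ∈ Submodule.span K (normMonomial '' (T : Set (Mat n))) := by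
  induction hx using Submodule.span_induction with
  | mem x hx =>
    obtain ⟨A, hA, rfl⟩ := hx
    rw [← sub_add_cancel (bar (normMonomial A)) (normMonomial A)]
    refine Submodule.add_mem _ ?_ (Submodule.subset_span ⟨A, hA, rfl⟩)
    exact Submodule.span_mono (Set.image_mono fun B hB => hT A hA B hB)
      (span_Lq_le (bar_normMonomial_sub_mem A))
  | zero => simp [bar]
  | add x y _ _ hx hy => rw [bar_add]; exact Submodule.add_mem _ hx hy
  | smul c x _ hx => rw [bar_smul]; exact Submodule.smul_mem _ _ hx

lemma coord_bar_normMonomial_self (A : Mat n) : coord n (bar (normMonomial A)) A = 1 := by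
  have h := coord_apply_eq_zero (Prec.irrefl A) (S := {B | Prec B A})
    (span_Lq_le (bar_normMonomial_sub_mem A))
  rw [map_sub, Finsupp.sub_apply, coord_normMonomial, Finsupp.single_eq_same, sub_eq_zero] at h
  exact h

/-- A nonempty finite lower set is obtained from a smaller one by adding a matrix. -/
lemma IsLower.exists_erase {T : Finset (Mat n)} (hT : IsLower T) (hne : T.Nonempty) :
    ∃ A ∈ T, IsLower (T.erase A) := by
  obtain ⟨A, hA, hmax⟩ := T.exists_max_image rank hne
  refine ⟨A, hA, fun B hB C hC => ?_⟩
  have hB' := Finset.mem_of_mem_erase hB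
  refine Finset.mem_erase.mpr ⟨?_, hT B hB' C hC⟩
  rintro rfl
  exact (hC.rank_lt.trans_le (hmax B hB')).false

lemma image_eq_insert {M : Type} (f : Mat n → M) {T : Finset (Mat n)} {A : Mat n} (hA : A ∈ T) :
    f '' (T : Set (Mat n)) = insert (f A) (f '' ((T.erase A : Finset (Mat n)) : Set (Mat n))) := by
  rw [← Set.image_insert_eq, ← Finset.coe_insert, Finset.insert_erase hA]

lemma bar_sub (x y : O n) : bar (x - y) = bar x - bar y := by simp [bar]

/-- A bar-antisymmetric element of the `ℤ[q, q⁻¹]`-lattice is `y - ȳ`, where `y` has coefficients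
in `q ℤ[q]`. -/
lemma IsLower.exists_sub_bar {T : Finset (Mat n)} (hT : IsLower T) {x : O n}
    (hx : x ∈ Submodule.span Lq (normMonomial '' (T : Set (Mat n)))) (hbar : bar x = -x) :
    ∃ y ∈ Submodule.span Zq ((fun A => q • normMonomial A) '' (T : Set (Mat n))),
      y - bar y = x := by
  induction hN : T.card generalizing T x with
  | zero =>
    rw [Finset.card_eq_zero] at hN
    subst hN
    refine ⟨0, Submodule.zero_mem _, ?_⟩
    simp only [Finset.coe_empty, Set.image_empty, Submodule.span_empty, Submodule.mem_bot] at hx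
    simp [hx, bar]
  | succ N ih =>
    obtain ⟨A, hA, hT'⟩ := hT.exists_erase (Finset.card_pos.mp (by omega))
    rw [image_eq_insert _ hA, Submodule.mem_span_insert] at hx
    obtain ⟨⟨r, hr⟩, x', hx', rfl⟩ := hx
    change bar (r • normMonomial A + x') = -(r • normMonomial A + x') at hbar
    have hnot : A ∉ ((T.erase A : Finset (Mat n)) : Set (Mat n)) := by simp
    -- `A` is not in the lower set that remains, and bar has coefficient 1 at `A`, so the
    -- antisymmetry of the whole element passes to its coefficient there.
    have hr' : barK r = -r := by
      have h := congrArg (fun z => coord n z A) hbar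
      simpa [bar_add, bar_smul, coord_normMonomial, coord_bar_normMonomial_self,
        coord_apply_eq_zero hnot (span_Lq_le hx'),
        coord_apply_eq_zero hnot (hT'.bar_mem_span (span_Lq_le hx'))] using h
    obtain ⟨p, hp, hpr⟩ := exists_sub_barK hr hr'
    set y₀ : O n := (q * p) • normMonomial A with hy₀
    have hbar₀ : bar (r • normMonomial A + x' - (y₀ - bar y₀)) =
        -(r • normMonomial A + x' - (y₀ - bar y₀)) := by
      rw [bar_sub, bar_sub, bar_bar, hbar]
      abel
    have hmem : r • normMonomial A + x' - (y₀ - bar y₀) ∈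
        Submodule.span Lq (normMonomial '' ((T.erase A : Finset (Mat n)) : Set (Mat n))) := by
      -- Subtracting `y₀ - bar y₀` cancels the coefficient at `A`; what is left over from `bar y₀`
      -- lies strictly below `A`.
      have e : r • normMonomial A + x' - (y₀ - bar y₀) =
          x' + barK (q * p) • (bar (normMonomial A) - normMonomial A) := by
        rw [hy₀, bar_smul, ← hpr]
        module
      rw [e]
      refine Submodule.add_mem _ hx' (smul_mem_of_mem_Lq
        (barK_mem_Lq (Zq_le_Lq (Subring.mul_mem _ q_mem_Zq hp))) ?_)
      refine Submodule.span_mono (Set.image_mono fun B hB => ?_) (bar_normMonomial_sub_mem A)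
      refine Finset.mem_coe.mpr (Finset.mem_erase.mpr ⟨?_, hT A hA B hB⟩)
      rintro rfl
      exact Prec.irrefl _ hB
    obtain ⟨y, hy, hyx⟩ := ih hT' hmem hbar₀ (by rw [Finset.card_erase_of_mem hA, hN]; rfl)
    refine ⟨y + y₀, Submodule.add_mem _ ?_ ?_, ?_⟩
    · exact Submodule.span_mono (Set.image_mono (Finset.coe_subset.mpr (T.erase_subset A))) hy
    · have : y₀ = (⟨p, hp⟩ : Zq) • q • normMonomial A := by
        rw [hy₀, mul_comm, mul_smul]
        rfl
      rw [this]
      exact Submodule.smul_mem _ _ (Submodule.subset_span ⟨A, hA, rfl⟩)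
    · rw [bar_add, add_sub_add_comm, hyx, sub_add_cancel]
      rfl

/-- A bar-invariant element with coefficients in `q ℤ[q]` is zero. -/
lemma IsLower.eq_zero_of_bar_eq {T : Finset (Mat n)} (hT : IsLower T) {x : O n}
    (hx : x ∈ Submodule.span Zq ((fun A => q • normMonomial A) '' (T : Set (Mat n))))
    (hbar : bar x = x) : x = 0 := by
  induction hN : T.card generalizing T x with
  | zero =>
    rw [Finset.card_eq_zero] at hN
    subst hN
    simpa using hx
  | succ N ih =>
    obtain ⟨A, hA, hT'⟩ := hT.exists_erase (Finset.card_pos.mp (by omega))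
    rw [image_eq_insert _ hA, Submodule.mem_span_insert] at hx
    obtain ⟨⟨p, hp⟩, x', hx', rfl⟩ := hx
    have e : (⟨p, hp⟩ : Zq) • q • normMonomial A = (q * p) • normMonomial A := by
      rw [mul_comm, mul_smul]
      rfl
    rw [e] at hbar ⊢
    have hnot : A ∉ ((T.erase A : Finset (Mat n)) : Set (Mat n)) := by simp
    have h0 : q * p = 0 := by
      refine eq_zero_of_barK_eq hp ?_
      have h := congrArg (fun z => coord n z A) hbar
      simp only [bar_add, bar_smul, map_add, map_smul, Finsupp.add_apply, Finsupp.smul_apply,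
        coord_normMonomial, coord_bar_normMonomial_self, Finsupp.single_eq_same,
        coord_apply_eq_zero hnot (span_Zq_le hx'),
        coord_apply_eq_zero hnot (hT'.bar_mem_span (span_Zq_le hx')), smul_eq_mul, mul_one,
        add_zero] at h
      exact h
    rw [h0, zero_smul, zero_add] at hbar ⊢
    exact ih hT' hx' hbar (by rw [Finset.card_erase_of_mem hA, hN]; rfl)

/-! ### The canonical basis -/

lemma finite_sameSums (A : Mat n) : {B : Mat n | ro B = ro A ∧ co B = co A}.Finite :=
  (finite_ro (ro A)).subset fun _ hB => hB.1

/-- The matrices with the row and column sums of `A`. -/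
def sameSums (A : Mat n) : Finset (Mat n) := (finite_sameSums A).toFinset

lemma mem_sameSums {A B : Mat n} : B ∈ sameSums A ↔ ro B = ro A ∧ co B = co A := by
  rw [sameSums, Set.Finite.mem_toFinset]
  rfl

lemma isLower_sameSums (A : Mat n) : IsLower (sameSums A) := by
  intro B hB C hC
  rw [mem_sameSums] at hB ⊢
  exact ⟨hC.2.1.trans hB.1, hC.2.2.trans hB.2⟩

/-- The span of the `q Z(B)` for `B` lower than `A`. -/
def qSpan (A : Mat n) : Submodule Zq (O n) :=
  Submodule.span Zq ((fun B => q • normMonomial B) '' {B | Prec B A})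

/-- If `bar Z(A) - Z(A) = y - bar y`, then `Z(A) + y` is bar invariant. -/
lemma exists_bar_invariant (A : Mat n) :
    ∃ b : O n, bar b = b ∧ b - normMonomial A ∈ qSpan A := by
  have hT : IsLower (finite_prec A).toFinset := by
    intro B hB C hC
    rw [Set.Finite.mem_toFinset] at hB ⊢
    exact hC.trans hB
  obtain ⟨y, hy, hyx⟩ := hT.exists_sub_bar (x := bar (normMonomial A) - normMonomial A)
    (by simpa only [Set.Finite.coe_toFinset] using bar_normMonomial_sub_mem A)
    (by rw [bar_sub, bar_bar, neg_sub])
  rw [Set.Finite.coe_toFinset] at hy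
  refine ⟨normMonomial A + y, ?_, by rwa [add_sub_cancel_left]⟩
  rw [bar_add]
  linear_combination (norm := abel) -hyx

lemma mem_qSpan_iff {A : Mat n} {y : O n} : y ∈ qSpan A ↔
    ∃ h : Mat n →₀ Polynomial ℤ,
      (∀ B ∈ h.support, LexLT B A ∧ ro B = ro A ∧ co B = co A ∧ Polynomial.X ∣ h B) ∧
      y = h.sum fun B p => evalq p • normMonomial B := by
  constructor
  · intro hy
    rw [qSpan, Finsupp.mem_span_image_iff_linearCombination] at hy
    obtain ⟨l, hl, rfl⟩ := hy
    -- Sending 0 to 0 is required for `mapRange` and keeps the support from growing.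
    have hg : ∀ c : Zq, ∃ p : Polynomial ℤ, evalq p = c ∧ (c = 0 → p = 0) := by
      intro c
      by_cases hc : c = 0
      · exact ⟨0, by simp [hc], fun _ => rfl⟩
      · obtain ⟨p, hp⟩ := c.2
        exact ⟨p, hp, fun h => absurd h hc⟩
    choose g hg hg0 using hg
    have h0 : Polynomial.X * g 0 = 0 := by rw [hg0 0 rfl, mul_zero]
    refine ⟨l.mapRange (fun c => Polynomial.X * g c) h0, ?_, ?_⟩
    · intro B hB
      have hB' : B ∈ l.support := Finsupp.support_mapRange hB
      have : Prec B A := (Finsupp.mem_supported _ _).mp hl hB'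
      exact ⟨this.1, this.2.1, this.2.2, by simp⟩
    · rw [Finsupp.sum_mapRange_index (by simp), Finsupp.linearCombination_apply]
      refine Finsupp.sum_congr fun B _ => ?_
      rw [map_mul, hg, mul_comm, mul_smul]
      simp [evalq]
      rfl
  · rintro ⟨h, hh, rfl⟩
    refine Submodule.sum_mem _ fun B hB => ?_
    obtain ⟨h1, h2, h3, p, hp⟩ := hh B hB
    have : evalq (h B) • normMonomial B =
        (⟨evalq p, p, rfl⟩ : Zq) • q • normMonomial B := by
      rw [hp, map_mul, mul_comm, mul_smul]
      simp [evalq]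
      rfl
    change evalq (h B) • normMonomial B ∈ _
    rw [this]
    exact Submodule.smul_mem _ _ (Submodule.subset_span ⟨B, ⟨h1, h2, h3⟩, rfl⟩)

lemma qSpan_le_lattice (A : Mat n) : qSpan A ≤ lattice n := by
  refine Submodule.span_le.mpr ?_
  rintro _ ⟨B, -, rfl⟩
  exact Submodule.smul_mem _ (⟨q, q_mem_Zq⟩ : Zq) (Submodule.subset_span ⟨B, rfl⟩)

/-- The unitriangular change of family is inverted by induction on `rank`. -/
lemma span_eq_lattice {b : Mat n → O n} (hb : ∀ A, b A - normMonomial A ∈ qSpan A) :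
    Submodule.span Zq (Set.range b) = lattice n := by
  apply le_antisymm
  · refine Submodule.span_le.mpr ?_
    rintro _ ⟨A, rfl⟩
    rw [← sub_add_cancel (b A) (normMonomial A)]
    exact Submodule.add_mem _ (qSpan_le_lattice A (hb A)) (Submodule.subset_span ⟨A, rfl⟩)
  · refine Submodule.span_le.mpr ?_
    rintro _ ⟨A, rfl⟩
    induction hN : rank A using Nat.strong_induction_on generalizing A with
    | _ N ih =>
      subst hN
      have hle : qSpan A ≤ Submodule.span Zq (Set.range b) := by
        refine Submodule.span_le.mpr ?_
        rintro _ ⟨B, hB, rfl⟩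
        exact Submodule.smul_mem _ (⟨q, q_mem_Zq⟩ : Zq) (ih _ (Prec.rank_lt hB) B rfl)
      rw [← sub_sub_cancel (b A) (normMonomial A)]
      exact Submodule.sub_mem _ (Submodule.subset_span ⟨A, rfl⟩) (hle (hb A))

/-- In a linear relation, choose an index of maximal `rank` with nonzero coefficient: no other term
contributes to that coordinate. -/
lemma linearIndependent_of_sub_mem {b : Mat n → O n}
    (hb : ∀ A, b A - normMonomial A ∈ qSpan A) : LinearIndependent Zq b := by
  have hc : ∀ A B, ¬ Prec A B → coord n (b B) A = Finsupp.single B 1 A := by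
    intro A B hAB
    have h := coord_apply_eq_zero (S := {C | Prec C B}) hAB (span_Zq_le (hb B))
    rwa [map_sub, Finsupp.sub_apply, coord_normMonomial, sub_eq_zero] at h
  rw [linearIndependent_iff']
  intro s g hg
  classical
  by_contra! hne
  have hne' : (s.filter fun A => g A ≠ 0).Nonempty := by
    obtain ⟨A, hA, hgA⟩ := hne
    exact ⟨A, Finset.mem_filter.mpr ⟨hA, hgA⟩⟩
  obtain ⟨A, hA, hmax⟩ := Finset.exists_max_image _ rank hne'
  rw [Finset.mem_filter] at hA
  have h := congrArg (fun z => coord n z A) hg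
  have hs : ∀ (c : Zq) (x : O n), coord n (c • x) A = (c : K) * coord n x A := by
    intro c x
    change coord n ((c : K) • x) A = _
    rw [map_smul]
    rfl
  simp only [map_sum, Finsupp.finsetSum_apply, hs, map_zero, Finsupp.coe_zero,
    Pi.zero_apply] at h
  rw [Finset.sum_eq_single A] at h
  · rw [hc A A (Prec.irrefl A), Finsupp.single_eq_same, mul_one] at h
    exact hA.2 (Subtype.ext h)
  · intro B hB hBA
    by_cases hgB : g B = 0
    · rw [hgB]; simp
    · rw [hc A B, Finsupp.single_eq_of_ne hBA.symm, mul_zero]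
      intro hAB
      exact (hAB.rank_lt.trans_le (hmax B (Finset.mem_filter.mpr ⟨hB, hgB⟩))).false
  · exact fun h => absurd hA.1 h

lemma IsCanonicalFamily.sub_mem_qSpan {b : Mat n → O n} (hb : IsCanonicalFamily b) (A : Mat n) :
    b A - normMonomial A ∈ qSpan A := by
  obtain ⟨h, hh, e⟩ := hb.expansion A
  rw [e, add_sub_cancel_left]
  exact mem_qSpan_iff.mpr ⟨h, hh, rfl⟩

/-! ### Uniqueness and compatibility with transposition -/

lemma qSpan_le_sameSums (A : Mat n) : qSpan A ≤
    Submodule.span Zq ((fun B => q • normMonomial B) '' (sameSums A : Set (Mat n))) :=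
  Submodule.span_mono (Set.image_mono fun _ hB => mem_sameSums.mpr hB.2)

/-- An order-free form of the uniqueness of the canonical basis. -/
lemma eq_of_bar_eq {A : Mat n} {x y : O n} (hx : bar x = x) (hy : bar y = y)
    (hx' : x - normMonomial A ∈
      Submodule.span Zq ((fun B => q • normMonomial B) '' (sameSums A : Set (Mat n))))
    (hy' : y - normMonomial A ∈ qSpan A) : x = y := by
  rw [← sub_eq_zero]
  refine (isLower_sameSums A).eq_zero_of_bar_eq ?_ (by rw [bar_sub, hx, hy])
  rw [← sub_sub_sub_cancel_right x y (normMonomial A)]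
  exact Submodule.sub_mem _ hx' (qSpan_le_sameSums A hy')

/-- Transposition swaps row and column sums but need not preserve the lexicographic order, so the
image is placed only in the span over `sameSums`, which is all that `eq_of_bar_eq` asks of its first
element. -/
lemma sigma_mem_span {A : Mat n} {x : O n} (hx : x ∈ qSpan A) : sigma n x ∈
    Submodule.span Zq ((fun B => q • normMonomial B) '' (sameSums A.transpose : Set (Mat n))) := by
  induction hx using Submodule.span_induction with
  | mem x hx =>
    obtain ⟨B, hB, rfl⟩ := hx
    refine Submodule.subset_span ⟨B.transpose, mem_sameSums.mpr ⟨hB.2.2, hB.2.1⟩, ?_⟩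
    simp only [map_smul, sigma_normMonomial]
  | zero => simp
  | add x y _ _ hx hy => rw [map_add]; exact Submodule.add_mem _ hx hy
  | smul c x _ hx =>
    have : sigma n (c • x) = c • sigma n x := map_smul (sigma n) (c : K) x
    rw [this]
    exact Submodule.smul_mem _ _ hx

lemma exists_isCanonicalFamily (n : ℕ) : ∃ b : Mat n → O n, IsCanonicalFamily b := by
  choose b hbar hb using exists_bar_invariant (n := n)
  refine ⟨b, linearIndependent_of_sub_mem hb, span_eq_lattice hb, hbar, fun A => ?_⟩
  obtain ⟨h, hh, e⟩ := mem_qSpan_iff.mp (hb A)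
  exact ⟨h, hh, by rw [← e, add_sub_cancel]⟩

lemma IsCanonicalFamily.eq {b b' : Mat n → O n} (hb : IsCanonicalFamily b)
    (hb' : IsCanonicalFamily b') : b = b' := by
  funext A
  exact eq_of_bar_eq (hb.bar_eq A) (hb'.bar_eq A) (qSpan_le_sameSums A (hb.sub_mem_qSpan A))
    (hb'.sub_mem_qSpan A)

lemma IsCanonicalFamily.sigma_eq {b : Mat n → O n} (hb : IsCanonicalFamily b) (A : Mat n) :
    sigma n (b A) = b A.transpose := by
  refine eq_of_bar_eq (A := A.transpose) (by rw [bar_sigma, hb.bar_eq]) (hb.bar_eq _) ?_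
    (hb.sub_mem_qSpan _)
  rw [← sigma_normMonomial, ← map_sub]
  exact sigma_mem_span (hb.sub_mem_qSpan A)


end

end QuantumMatrix

/-! ### The theorem -/

theorem corollary3p4 (n : ℕ) :
    (∃! b : QuantumMatrix.Mat n → QuantumMatrix.O n, QuantumMatrix.IsCanonicalFamily b) ∧
    ∀ b : QuantumMatrix.Mat n → QuantumMatrix.O n, QuantumMatrix.IsCanonicalFamily b →
      (QuantumMatrix.sigma n) '' Set.range b = Set.range b ∧
      ∀ A : QuantumMatrix.Mat n, QuantumMatrix.sigma n (b A) = b A.transpose := by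
  refine ⟨?_, fun b hb => ⟨?_, hb.sigma_eq⟩⟩
  · obtain ⟨b, hb⟩ := QuantumMatrix.exists_isCanonicalFamily n
    exact ⟨b, hb, fun b' hb' => hb'.eq hb⟩
  · ext x
    constructor
    · rintro ⟨_, ⟨A, rfl⟩, rfl⟩
      exact ⟨A.transpose, (hb.sigma_eq A).symm⟩
    · rintro ⟨A, rfl⟩
      exact ⟨b A.transpose, ⟨_, rfl⟩, by rw [hb.sigma_eq, Matrix.transpose_transpose]⟩
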